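/- **Proposition (theta functions of cosets of $A_6$).** Let $A_6=\{x\in\mathbb Z^7 : x_1+\dots+x_7=0\}$ with the Euclidean norm $x^2=\sum_i x_i^2$, and let $A_6^*$ be its dual lattice, i.e. the set of all $x$ in the real span of $A_6$ such that $(x,y)\in\mathbb Z$ for all $y\in A_6$. For $r\in A_6^*$ put $\delta(r)=1$ if $r\in A_6$ and $\delta(r)=0$ otherwise. Let $\tau\in\mathbb C$ with $\operatorname{Im}\tau>0$, write $q^s=e^{2\pi i\tau s}$ for real $s$, let $\varepsilon=e^{2\pi i/7}$, and let $\eta$ be the Dedekind eta function, regarded as a function of $q$: $\eta(q)=q^{1/24}\prod_{n\ge 1}(1-q^n)$, where $\eta(q^k)$ denotes its value at $k\tau$ and $\eta\big((\varepsilon^jq^{1/7})^k\big)$ its value at $k(\tau+j)/7$. Then, for every $r\in A_6^*$, the series $\theta_{r+A_6}(q)=\sum_{v\in r+A_6}q^{v^2/2}$ converges absolutely and $$\theta_{r+A_6}(q)=\frac18\,\frac{\eta(q)^{14}}{\eta(q^2)^7}\left\{\frac{\eta(q^{14})}{\eta(q^7)^2}\,\delta(r)+\sum_{j=0}^{6}\varepsilon^{-7jr^2/2}\,\frac{\eta\big((\varepsilon^jq^{1/7})^2\big)}{\eta\big(\varepsilon^jq^{1/7}\big)^2}\right\}.$$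 -/

import Mathlib

noncomputable section

namespace CosetTheta

/-- The root lattice `A_6`: the integral vectors of coordinate sum zero in Euclidean `ℝ^7`. -/
def latticeA6 : AddSubgroup (EuclideanSpace ℝ (Fin 7)) where
  carrier := {x | (∀ i, ∃ m : ℤ, x i = m) ∧ ∑ i, x i = 0}
  zero_mem' := ⟨fun _ => ⟨0, by simp⟩, by simp⟩
  add_mem' := by
    rintro x y ⟨hx, hx0⟩ ⟨hy, hy0⟩
    refine ⟨fun i => ?_, ?_⟩
    · obtain ⟨a, ha⟩ := hx i
      obtain ⟨b, hb⟩ := hy i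
      exact ⟨a + b, by simp [ha, hb]⟩
    · simp [Finset.sum_add_distrib, hx0, hy0]
  neg_mem' := by
    rintro x ⟨hx, hx0⟩
    refine ⟨fun i => ?_, ?_⟩
    · obtain ⟨a, ha⟩ := hx i
      exact ⟨-a, by simp [ha]⟩
    · simp [hx0]

/-- The dual lattice `L^*`: the vectors of the real span of `L` whose inner product with every
vector of `L` is an integer. -/
def dualLattice {E : Type*} [NormedAddCommGroup E] [InnerProductSpace ℝ E]
    (L : AddSubgroup E) : Set E :=
  {x | x ∈ Submodule.span ℝ (L : Set E) ∧ ∀ y ∈ L, ∃ m : ℤ, inner ℝ x y = m}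

/-- The term `q^{(r + v)² / 2}` for `q = e^{2πiτ}`, where `(r + v)²` is the Euclidean norm. -/
def thetaTerm {E : Type*} [NormedAddCommGroup E] (r : E) (τ : ℂ) (v : E) : ℂ :=
  Complex.exp (2 * Real.pi * Complex.I * τ * ((‖r + v‖ ^ 2 / 2 : ℝ) : ℂ))

/-- The theta function `θ_{r + L}(q) = ∑_{w ∈ r + L} q^{w² / 2}` of a translated lattice,
as a function of `τ` with `q = e^{2πiτ}`. -/
def cosetTheta {E : Type*} [NormedAddCommGroup E] (L : AddSubgroup E) (r : E) (τ : ℂ) : ℂ :=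
  ∑' v : L, thetaTerm r τ (v : E)

open Classical in
/-- `δ(r) = 1` if `r ∈ L` and `δ(r) = 0` otherwise. -/
def latticeDelta {E : Type*} [AddGroup E] (L : AddSubgroup E) (r : E) : ℂ :=
  if r ∈ L then 1 else 0

/-- The root of unity `ε = e^{2πi/7}`. -/
def eps7 : ℂ := Complex.exp (2 * Real.pi * Complex.I / 7)

end CosetTheta

end

namespace CosetTheta

/-! Put φ(τ) = η(τ)²/η(2τ), which equals θ₄(2τ) by Gauss (`gaussPhi_eq_eta`). Every eta quotient on
the right is a power of φ, and the claim becomes 8 φ(τ)⁻⁷ Θ_m(τ) = δ/φ(7τ) + ∑_j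
e^{8πijm²/7}/φ((τ+8j)/7), where Θ_m belongs to the coset of the vectors n - (m/7, …, m/7) with n
integral of sum m. Both sides are even and 7-periodic in m, so their difference, essentially
`defect`, has only the four free values m = 0, 1, 2, 3.

Four linear relations kill it. Grouping ℤ⁷ by coordinate sum expresses the seventh power of the
Jacobi theta function at w as a pairing of the Θ_m with exponentials in m (`hasSum_fiberTheta`). The
half periods w = 0, 1/2, τ/2 produce θ₃⁷, θ₄⁷, θ₂⁷, and the derivative at the zero w = (1+τ)/2
produces 0. Paired with the same series, the right side becomes a sum over the eight points 7τ and
(τ+8j)/7 of θ₃/φ, θ₄/φ, θ₂/φ and, in the derivative case, of multiples of θ₂φ.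

With u = θ₃/φ the values v at the eight points are the roots of the modular equation (uv-1)⁸ =
(u⁸-1)(v⁸-1), which rests on the theta series of the form s²+st+2t². Vieta then gives ∑ v = 8u⁷. The
θ₄ relation is its image under inversion, since θ₄/φ = 1/u; the θ₂ relation follows from ww' = uv -
2 + 1/(uv), with w = θ₂/φ. The derivative relation holds because x²+y² is anisotropic modulo 7.

When Im τ is large the eight roots are distinct (`exists_heckeValue_injective`) and comparison of
leading terms shows the four relations to be independent (`exists_eq_zero_of_theta_relations`), so
the defect vanishes. The identity theorem carries the result to the whole upper half-plane. -/

open Complex Filter Topology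
open scoped Real

/-! ### Jacobi's triple product as a limit of the q-binomial theorem. -/

/-- The Gaussian binomial coefficient, by its Pascal recursion. -/
noncomputable def gaussBinom (q : ℂ) : ℕ → ℕ → ℂ
  | _, 0 => 1
  | 0, _ + 1 => 0
  | N + 1, m + 1 => gaussBinom q N m + q ^ (m + 1) * gaussBinom q N (m + 1)

/-- The finite product `(q; q)_n`. -/
noncomputable def eulerPoly (q : ℂ) (n : ℕ) : ℂ := ∏ k ∈ Finset.range n, (1 - q ^ (k + 1))

/-- The infinite product `(q; q)_∞`. -/
noncomputable def eulerProd (q : ℂ) : ℂ := ∏' k : ℕ, (1 - q ^ (k + 1))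

/-- The infinite product `∏ (1 + a q^k)`. -/
noncomputable def shiftedProd (a q : ℂ) : ℂ := ∏' k : ℕ, (1 + a * q ^ k)

lemma gaussBinom_zero_right (q : ℂ) (N : ℕ) : gaussBinom q N 0 = 1 := by
  cases N <;> rfl

lemma gaussBinom_eq_zero (q : ℂ) {N m : ℕ} (h : N < m) : gaussBinom q N m = 0 := by
  induction N generalizing m with
  | zero => obtain ⟨m, rfl⟩ := Nat.exists_eq_succ_of_ne_zero h.ne'; rfl
  | succ N ih =>
    obtain ⟨m, rfl⟩ := Nat.exists_eq_succ_of_ne_zero (Nat.ne_of_gt (Nat.zero_lt_of_lt h))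
    rw [gaussBinom, ih (by omega), ih (by omega)]; simp

lemma eulerPoly_succ (q : ℂ) (n : ℕ) :
    eulerPoly q (n + 1) = eulerPoly q n * (1 - q ^ (n + 1)) := Finset.prod_range_succ _ _

/-- The factorial formula with denominators cleared, so that no condition on q is needed. The
induction rests on 1 - q^(N+1) = (1 - q^(m+1)) + q^(m+1) (1 - q^(k+1)) with N + 1 = (m+1) + (k+1).
-/
lemma gaussBinom_mul (q : ℂ) (N m k : ℕ) (h : N = m + k) :
    gaussBinom q N m * (eulerPoly q m * eulerPoly q k) = eulerPoly q N := by
  induction N generalizing m k with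
  | zero =>
    obtain ⟨rfl, rfl⟩ : m = 0 ∧ k = 0 := by omega
    simp [gaussBinom, eulerPoly]
  | succ N ih =>
    cases m with
    | zero =>
      obtain rfl : k = N + 1 := by omega
      simp [gaussBinom, eulerPoly]
    | succ m =>
      rw [gaussBinom]
      cases k with
      | zero =>
        obtain rfl : N = m := by omega
        have h1 := ih N 0 rfl
        rw [gaussBinom_eq_zero q (Nat.lt_succ_self N), eulerPoly_succ]
        linear_combination (1 - q ^ (N + 1)) * h1
      | succ k =>
        have h1 := ih m (k + 1) (by omega)
        have h2 := ih (m + 1) k (by omega)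
        have h3 : q ^ (N + 1) = q ^ (m + 1) * q ^ (k + 1) := by rw [← pow_add]; congr 1
        rw [eulerPoly_succ q N, h3]
        rw [eulerPoly_succ q m, eulerPoly_succ q k] at *
        linear_combination (1 - q ^ (m + 1)) * h1 + q ^ (m + 1) * (1 - q ^ (k + 1)) * h2

/-- The `q`-binomial theorem. -/
lemma prod_one_add_mul_pow (q x : ℂ) (N : ℕ) :
    ∏ k ∈ Finset.range N, (1 + x * q ^ k) =
      ∑ m ∈ Finset.range (N + 1), gaussBinom q N m * q ^ (m.choose 2) * x ^ m := by
  induction N generalizing x with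
  | zero => simp [gaussBinom]
  | succ N ih =>
    have h1 : ∏ k ∈ Finset.range (N + 1), (1 + x * q ^ k) =
        (1 + x) * ∏ k ∈ Finset.range N, (1 + x * q * q ^ k) := by
      rw [Finset.prod_range_succ', mul_comm]
      simp [pow_succ', mul_assoc]
    have h2 : ∑ m ∈ Finset.range (N + 1), gaussBinom q N m * q ^ (m.choose 2) * (x * q) ^ m =
        1 + ∑ m ∈ Finset.range (N + 1),
          q ^ (m + 1) * gaussBinom q N (m + 1) * q ^ ((m + 1).choose 2) * x ^ (m + 1) := by
      rw [Finset.sum_range_succ', add_comm, Finset.sum_range_succ _ N,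
        gaussBinom_eq_zero q (Nat.lt_succ_self N)]
      simp [gaussBinom_zero_right]
      refine Finset.sum_congr rfl fun m _ => ?_
      ring
    have h3 : x * ∑ m ∈ Finset.range (N + 1), gaussBinom q N m * q ^ (m.choose 2) * (x * q) ^ m =
        ∑ m ∈ Finset.range (N + 1),
          gaussBinom q N m * q ^ ((m + 1).choose 2) * x ^ (m + 1) := by
      rw [Finset.mul_sum]
      refine Finset.sum_congr rfl fun m _ => ?_
      rw [Nat.choose_succ_succ' m 1, Nat.choose_one_right]
      ring
    rw [h1, ih, add_mul, one_mul, h3, h2, Finset.sum_range_succ' _ (N + 1)]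
    simp only [gaussBinom, Nat.choose_zero_succ, pow_zero, mul_one, add_mul,
      Finset.sum_add_distrib]
    ring

lemma multipliable_shiftedProd (a : ℂ) {q : ℂ} (hq : ‖q‖ < 1) :
    Multipliable fun k : ℕ => 1 + a * q ^ k := by
  refine multipliable_one_add_of_summable ?_
  simpa using (summable_geometric_of_lt_one (norm_nonneg q) hq).mul_left ‖a‖

lemma tendsto_eulerPoly {q : ℂ} (hq : ‖q‖ < 1) :
    Tendsto (eulerPoly q) atTop (𝓝 (eulerProd q)) :=
  (ModularForm.multipliable_one_sub_pow hq).hasProd.tendsto_prod_nat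

lemma one_sub_pow_ne_zero {q : ℂ} (hq : ‖q‖ < 1) (k : ℕ) : 1 - q ^ (k + 1) ≠ 0 := by
  intro h
  have h1 : ‖q ^ (k + 1)‖ = 1 := by rw [← sub_eq_zero.mp h]; simp
  rw [norm_pow] at h1
  exact (pow_lt_one₀ (norm_nonneg q) hq (Nat.succ_ne_zero k)).ne h1

lemma eulerPoly_ne_zero {q : ℂ} (hq : ‖q‖ < 1) (n : ℕ) : eulerPoly q n ≠ 0 :=
  Finset.prod_ne_zero_iff.mpr fun k _ => one_sub_pow_ne_zero hq k

lemma shiftedProd_ne_zero {a q : ℂ} (hq : ‖q‖ < 1) (h : ∀ k : ℕ, 1 + a * q ^ k ≠ 0) :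
    shiftedProd a q ≠ 0 := by
  refine tprod_one_add_ne_zero_of_summable (f := fun k : ℕ => a * q ^ k) h ?_
  simpa using (summable_geometric_of_lt_one (norm_nonneg q) hq).mul_left ‖a‖

lemma eulerProd_eq_shiftedProd (q : ℂ) : eulerProd q = shiftedProd (-q) q := by
  unfold eulerProd shiftedProd
  congr 1; ext k; ring

lemma eulerProd_ne_zero {q : ℂ} (hq : ‖q‖ < 1) : eulerProd q ≠ 0 := by
  rw [eulerProd_eq_shiftedProd]
  refine shiftedProd_ne_zero hq fun k => ?_
  have := one_sub_pow_ne_zero hq k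
  convert this using 1; ring

/-- The finite form of the triple product identity. -/
lemma prod_mul_prod_eq_sum (z τ : ℂ) (n : ℕ) :
    (∏ k ∈ Finset.range n, (1 + cexp (2 * π * I * z + π * I * τ) * cexp (2 * π * I * τ) ^ k)) *
      (∏ k ∈ Finset.range n, (1 + cexp (-(2 * π * I * z) + π * I * τ) * cexp (2 * π * I * τ) ^ k)) =
    ∑ m ∈ Finset.range (2 * n + 1), gaussBinom (cexp (2 * π * I * τ)) (2 * n) m *
      jacobiTheta₂_term ((m : ℤ) - n) z τ := by
  set q := cexp (2 * π * I * τ) with hq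
  set a := cexp (2 * π * I * z + π * I * τ) with ha
  set b := cexp (-(2 * π * I * z) + π * I * τ) with hb
  have hprod : ∏ k ∈ Finset.range n, (b * q ^ k) = jacobiTheta₂_term (-(n : ℤ)) z τ := by
    clear_value a
    induction n with
    | zero => simp [jacobiTheta₂_term]
    | succ n ih =>
      rw [Finset.prod_range_succ, ih, hb, hq, jacobiTheta₂_term, jacobiTheta₂_term, ← exp_nat_mul,
        ← exp_add, ← exp_add]
      congr 1; push_cast; ring
  -- The base point is a q^(-n): the last n of the 2n factors are the 1 + a q^k, and the first n,
  -- reversed, are the 1 + (b q^k)⁻¹.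
  have key := prod_one_add_mul_pow q (cexp (2 * π * I * z + π * I * τ - 2 * π * I * τ * n)) (2 * n)
  have hsplit : ∏ k ∈ Finset.range (2 * n),
      (1 + cexp (2 * π * I * z + π * I * τ - 2 * π * I * τ * n) * q ^ k) =
      (∏ k ∈ Finset.range n, (b * q ^ k)⁻¹ * (1 + b * q ^ k)) *
        ∏ k ∈ Finset.range n, (1 + a * q ^ k) := by
    rw [two_mul, Finset.prod_range_add, ← Finset.prod_range_reflect]
    congr 1
    · refine Finset.prod_congr rfl fun k hk => ?_
      have hk' : k + 1 ≤ n := Finset.mem_range.mp hk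
      have hbq : b * q ^ k ≠ 0 := mul_ne_zero (exp_ne_zero _) (pow_ne_zero _ (exp_ne_zero _))
      rw [mul_add, mul_one, inv_mul_cancel₀ hbq, add_comm]
      congr 1
      rw [hb, hq, ← exp_nat_mul, ← exp_nat_mul, ← exp_add, ← exp_add, ← exp_neg]
      congr 1
      rw [show n - 1 - k = n - (k + 1) by omega, Nat.cast_sub hk']
      push_cast; ring
    · refine Finset.prod_congr rfl fun k _ => ?_
      congr 1
      rw [pow_add, ← mul_assoc]
      congr 1
      rw [ha, hq, ← exp_nat_mul, ← exp_add]
      congr 1; ring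
  rw [hsplit, Finset.prod_mul_distrib, Finset.prod_inv_distrib, hprod] at key
  have hne : jacobiTheta₂_term (-(n : ℤ)) z τ ≠ 0 := exp_ne_zero _
  have key2 : (∏ k ∈ Finset.range n, (1 + a * q ^ k)) * (∏ k ∈ Finset.range n, (1 + b * q ^ k)) =
      jacobiTheta₂_term (-(n : ℤ)) z τ * ∑ m ∈ Finset.range (2 * n + 1),
        gaussBinom q (2 * n) m * q ^ (m.choose 2) *
          cexp (2 * π * I * z + π * I * τ - 2 * π * I * τ * n) ^ m := by
    rw [← key]; field_simp
  rw [key2, Finset.mul_sum]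
  refine Finset.sum_congr rfl fun m _ => ?_
  rw [mul_assoc, mul_left_comm]
  congr 1
  rw [jacobiTheta₂_term, jacobiTheta₂_term, hq, ← exp_nat_mul, ← exp_nat_mul, ← exp_add, ← exp_add]
  congr 1
  rw [Nat.cast_choose_two]
  push_cast; ring

lemma norm_cexp_two_pi_lt_one {τ : ℂ} (hτ : 0 < τ.im) : ‖cexp (2 * π * I * τ)‖ < 1 := by
  simpa using UpperHalfPlane.norm_exp_two_pi_I_lt_one ⟨τ, hτ⟩

/-- Jacobi's triple product identity. -/
theorem jacobiTheta₂_eq_prod (z : ℂ) {τ : ℂ} (hτ : 0 < τ.im) :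
    jacobiTheta₂ z τ = eulerProd (cexp (2 * π * I * τ)) *
      (shiftedProd (cexp (2 * π * I * z + π * I * τ)) (cexp (2 * π * I * τ)) *
        shiftedProd (cexp (-(2 * π * I * z) + π * I * τ)) (cexp (2 * π * I * τ))) := by
  set q := cexp (2 * π * I * τ) with hq
  have hq1 : ‖q‖ < 1 := norm_cexp_two_pi_lt_one hτ
  have hE := eulerProd_ne_zero hq1
  have hlim := tendsto_eulerPoly hq1
  obtain ⟨C, hC⟩ := hlim.norm.bddAbove_range
  obtain ⟨D, hD⟩ := (hlim.inv₀ hE).norm.bddAbove_range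
  have hC' (n) : ‖eulerPoly q n‖ ≤ C := hC ⟨n, rfl⟩
  have hD' (n) : ‖(eulerPoly q n)⁻¹‖ ≤ D := hD ⟨n, rfl⟩
  have hC0 : 0 ≤ C := (norm_nonneg _).trans (hC' 0)
  have hD0 : 0 ≤ D := (norm_nonneg _).trans (hD' 0)
  -- Extending the coefficients by zero to all of ℤ allows dominated convergence: they equal
  -- (q)_{2n} / ((q)_{n+j} (q)_{n-j}) on the window, tend to 1/(q)_∞, and are bounded by C D².
  let c : ℕ → ℤ → ℂ := fun n j => if -(n : ℤ) ≤ j ∧ j ≤ n then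
    gaussBinom q (2 * n) (j + n).toNat else 0
  have hc (n : ℕ) (j : ℤ) (hj : -(n : ℤ) ≤ j ∧ j ≤ n) :
      c n j = eulerPoly q (2 * n) * ((eulerPoly q (j + n).toNat)⁻¹ *
        (eulerPoly q (n - j).toNat)⁻¹) := by
    have h := gaussBinom_mul q (2 * n) (j + n).toNat (n - j).toNat (by omega)
    simp only [c, if_pos hj]
    rw [← h, ← mul_inv]
    exact (mul_inv_cancel_right₀
      (mul_ne_zero (eulerPoly_ne_zero hq1 _) (eulerPoly_ne_zero hq1 _)) _).symm
  have hfin (n : ℕ) : ∑' j : ℤ, c n j * jacobiTheta₂_term j z τ =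
      ∑ m ∈ Finset.range (2 * n + 1), gaussBinom q (2 * n) m *
        jacobiTheta₂_term ((m : ℤ) - n) z τ := by
    have himg : ∑ m ∈ Finset.range (2 * n + 1), gaussBinom q (2 * n) m *
        jacobiTheta₂_term ((m : ℤ) - n) z τ =
        ∑ j ∈ Finset.Icc (-(n : ℤ)) n, c n j * jacobiTheta₂_term j z τ := by
      refine Finset.sum_bij' (fun m _ => (m : ℤ) - n) (fun j _ => (j + n).toNat)
        ?_ ?_ ?_ ?_ ?_
      · intro m hm; simp only [Finset.mem_range, Finset.mem_Icc] at *; omega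
      · intro j hj; simp only [Finset.mem_range, Finset.mem_Icc] at *; omega
      · intro m hm; simp only [Finset.mem_range] at *; omega
      · intro j hj; simp only [Finset.mem_Icc] at *; omega
      · intro m hm
        simp only [Finset.mem_range] at hm
        simp only [c]
        rw [if_pos (by omega), show ((m : ℤ) - n + n).toNat = m by omega]
    rw [himg]
    refine tsum_eq_sum fun j hj => ?_
    simp only [c]
    rw [if_neg (by simpa [Finset.mem_Icc] using hj), zero_mul]
  have h1 : Tendsto (fun n => ∑' j : ℤ, c n j * jacobiTheta₂_term j z τ) atTop
      (𝓝 (∑' j : ℤ, (eulerProd q)⁻¹ * jacobiTheta₂_term j z τ)) := by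
    refine tendsto_tsum_of_dominated_convergence
      (bound := fun j => C * (D * D) * ‖jacobiTheta₂_term j z τ‖) ?_ ?_ ?_
    · exact (hasSum_jacobiTheta₂_term z hτ).summable.norm.mul_left _
    · intro j
      refine Tendsto.mul_const _ ?_
      have hto (f : ℕ → ℕ) (hf : ∀ n, n ≤ f n + j.natAbs) : Tendsto f atTop atTop := by
        refine tendsto_atTop.mpr fun b => ?_
        filter_upwards [eventually_ge_atTop (b + j.natAbs)] with n hn
        have := hf n
        omega
      have ha : Tendsto (fun n : ℕ => eulerPoly q (2 * n) * ((eulerPoly q (j + n).toNat)⁻¹ *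
          (eulerPoly q (n - j).toNat)⁻¹)) atTop (𝓝 (eulerProd q * ((eulerProd q)⁻¹ *
            (eulerProd q)⁻¹))) := by
        refine (hlim.comp (hto _ fun n => by omega)).mul
          (((hlim.comp (hto _ fun n => by omega)).inv₀ hE).mul
            ((hlim.comp (hto _ fun n => by omega)).inv₀ hE))
      rw [mul_inv_cancel_left₀ hE] at ha
      refine ha.congr' ?_
      filter_upwards [eventually_ge_atTop j.natAbs] with n hn
      rw [hc n j (by omega)]
    · refine Eventually.of_forall fun n j => ?_
      rw [norm_mul]
      refine mul_le_mul_of_nonneg_right ?_ (norm_nonneg _)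
      by_cases hj : -(n : ℤ) ≤ j ∧ j ≤ n
      · rw [hc n j hj, norm_mul, norm_mul]
        gcongr
        · exact hC' _
        · exact hD' _
        · exact hD' _
      · simp only [c, if_neg hj, norm_zero]
        positivity
  rw [tsum_mul_left] at h1
  have h2 := (multipliable_shiftedProd (cexp (2 * π * I * z + π * I * τ)) hq1).hasProd.tendsto_prod_nat.mul
    (multipliable_shiftedProd (cexp (-(2 * π * I * z) + π * I * τ)) hq1).hasProd.tendsto_prod_nat
  have h3 := tendsto_nhds_unique (h1.congr fun n => (hfin n).trans
    (prod_mul_prod_eq_sum z τ n).symm) h2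
  change _ = shiftedProd _ _ * shiftedProd _ _ at h3
  rw [← h3, jacobiTheta₂, mul_inv_cancel_left₀ hE]

/-! ### Theta constants, their products, and the derivative at the half period. -/

/-- The theta constant `∑ x^{(n + 1/2)²}`, `x = e^{πiτ}`. -/
noncomputable def theta2 (τ : ℂ) : ℂ := cexp (π * I * τ / 4) * jacobiTheta₂ (τ / 2) τ

/-- The theta constant `∑ x^{n²}`, `x = e^{πiτ}`. -/
noncomputable def theta3 (τ : ℂ) : ℂ := jacobiTheta₂ 0 τ

/-- The theta constant `∑ (-1)^n x^{n²}`, `x = e^{πiτ}`. -/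
noncomputable def theta4 (τ : ℂ) : ℂ := jacobiTheta₂ (1 / 2) τ

/-- The value `θ₄(2τ) = ∑ (-1)^n q^{n²}`, `q = e^{2πiτ}`. -/
noncomputable def gaussPhi (τ : ℂ) : ℂ := theta4 (2 * τ)

lemma cexp_pi_mul_int (n : ℤ) : cexp (π * I * n) = (-1) ^ n := by
  rw [mul_comm, exp_int_mul, exp_pi_mul_I]

lemma hasSum_theta2 {τ : ℂ} (hτ : 0 < τ.im) :
    HasSum (fun n : ℤ => cexp (π * I * τ * (n + 1 / 2) ^ 2)) (theta2 τ) := by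
  refine ((hasSum_jacobiTheta₂_term (τ / 2) hτ).mul_left (cexp (π * I * τ / 4))).congr_fun ?_
  intro n
  rw [jacobiTheta₂_term, ← exp_add]
  congr 1; ring

lemma hasSum_theta3 {τ : ℂ} (hτ : 0 < τ.im) :
    HasSum (fun n : ℤ => cexp (π * I * τ * n ^ 2)) (theta3 τ) := by
  refine (hasSum_jacobiTheta₂_term 0 hτ).congr_fun ?_
  intro n
  rw [jacobiTheta₂_term]
  congr 1; ring

lemma hasSum_theta4 {τ : ℂ} (hτ : 0 < τ.im) :
    HasSum (fun n : ℤ => (-1) ^ n * cexp (π * I * τ * n ^ 2)) (theta4 τ) := by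
  refine (hasSum_jacobiTheta₂_term (1 / 2) hτ).congr_fun ?_
  intro n
  rw [jacobiTheta₂_term, ← cexp_pi_mul_int, ← exp_add]
  congr 1; ring

lemma eta_eq (τ : ℂ) : ModularForm.eta τ =
    cexp (2 * π * I * τ / 24) * eulerProd (cexp (2 * π * I * τ)) := by
  simp [ModularForm.eta, eulerProd, ModularForm.eta_q, Function.Periodic.qParam]

lemma eulerProd_eq_mul {q : ℂ} (hq : ‖q‖ < 1) :
    eulerProd q = shiftedProd (-q) (q ^ 2) * eulerProd (q ^ 2) := by
  have hq2 : ‖q ^ 2‖ < 1 := by rw [norm_pow]; exact pow_lt_one₀ (norm_nonneg q) hq two_ne_zero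
  have he (k : ℕ) : 1 - q ^ (2 * k + 1) = 1 + -q * (q ^ 2) ^ k := by ring
  have ho (k : ℕ) : 1 - q ^ (2 * k + 1 + 1) = 1 - (q ^ 2) ^ (k + 1) := by ring
  have := tprod_even_mul_odd (f := fun k : ℕ => 1 - q ^ (k + 1))
    (by simp only [he]; exact multipliable_shiftedProd _ hq2)
    (by simp only [ho]; exact ModularForm.multipliable_one_sub_pow hq2)
  simp only [he, ho] at this
  exact this.symm

lemma shiftedProd_self_mul_eulerProd {q : ℂ} (hq : ‖q‖ < 1) :
    shiftedProd q q * eulerProd q = eulerProd (q ^ 2) := by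
  unfold shiftedProd eulerProd
  rw [← (multipliable_shiftedProd q hq).tprod_mul (ModularForm.multipliable_one_sub_pow hq)]
  congr 1; ext k; ring

lemma shiftedProd_eq_mul (a : ℂ) {q : ℂ} (hq : ‖q‖ < 1) :
    shiftedProd a q = (1 + a) * shiftedProd (a * q) q := by
  unfold shiftedProd
  have h : Multipliable fun k : ℕ => 1 + a * q ^ (k + 1) := by
    simpa [pow_succ', mul_assoc] using multipliable_shiftedProd (a * q) hq
  have h2 := tprod_eq_zero_mul' (f := fun k : ℕ => 1 + a * q ^ k) h
  rw [h2]
  simp [pow_succ', mul_assoc]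

/-- Supplies the continuity of the cofactor of the vanishing factor in `jacobiTheta₂'_half_period`.
-/
lemma continuous_shiftedProd {q : ℂ} (hq : ‖q‖ < 1) :
    Continuous fun a => shiftedProd a q := by
  rw [continuous_iff_continuousAt]
  intro a
  have hK : IsCompact (Metric.closedBall (0 : ℂ) (‖a‖ + 1)) := isCompact_closedBall _ _
  have h := ((summable_geometric_of_lt_one (norm_nonneg q) hq).mul_left
    (‖a‖ + 1)).hasProdUniformlyOn_nat_one_add (f := fun (k : ℕ) (b : ℂ) => b * q ^ k) hK
    (Eventually.of_forall fun k b hb => by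
      rw [norm_mul, norm_pow]
      gcongr
      simpa using hb) (fun k => by fun_prop)
  rw [hasProdUniformlyOn_iff_tendstoUniformlyOn] at h
  have hc : ContinuousOn (fun b => shiftedProd b q) (Metric.closedBall (0 : ℂ) (‖a‖ + 1)) :=
    h.continuousOn (Frequently.of_forall fun s => by fun_prop)
  exact hc.continuousAt (Metric.closedBall_mem_nhds_of_mem (by simp))

lemma two_mul_im_pos {τ : ℂ} (hτ : 0 < τ.im) : 0 < (2 * τ).im := by
  simpa using hτ

lemma gaussPhi_eq_eulerProd {τ : ℂ} (hτ : 0 < τ.im) :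
    gaussPhi τ = eulerProd (cexp (2 * π * I * τ)) ^ 2 / eulerProd (cexp (2 * π * I * τ) ^ 2) := by
  set q := cexp (2 * π * I * τ) with hq
  have hq1 : ‖q‖ < 1 := norm_cexp_two_pi_lt_one hτ
  have hq2 : ‖q ^ 2‖ < 1 := by rw [norm_pow]; exact pow_lt_one₀ (norm_nonneg q) hq1 two_ne_zero
  have h1 : cexp (2 * π * I * (2 * τ)) = q ^ 2 := by rw [hq, ← exp_nat_mul]; congr 1; push_cast; ring
  have h2 : cexp (2 * π * I * (1 / 2) + π * I * (2 * τ)) = -q := by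
    rw [show (2 * π * I * (1 / 2) + π * I * (2 * τ) : ℂ) = 2 * π * I * τ + π * I by ring, exp_add,
      exp_pi_mul_I]; ring
  have h3 : cexp (-(2 * π * I * (1 / 2)) + π * I * (2 * τ)) = -q := by
    rw [show (-(2 * π * I * (1 / 2)) + π * I * (2 * τ) : ℂ) = 2 * π * I * τ - π * I by ring, exp_sub,
      exp_pi_mul_I]; ring
  rw [gaussPhi, theta4, jacobiTheta₂_eq_prod _ (two_mul_im_pos hτ), h1, h2, h3, eulerProd_eq_mul hq1]
  have := eulerProd_ne_zero hq2
  field_simp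

/-- Gauss's identity `∑ (-1)^n q^{n²} = η(τ)² / η(2τ)`. -/
theorem gaussPhi_eq_eta {τ : ℂ} (hτ : 0 < τ.im) :
    gaussPhi τ = ModularForm.eta τ ^ 2 / ModularForm.eta (2 * τ) := by
  have h1 : cexp (2 * π * I * (2 * τ)) = cexp (2 * π * I * τ) ^ 2 := by
    rw [← exp_nat_mul]; congr 1; push_cast; ring
  have h2 : cexp (2 * π * I * (2 * τ) / 24) = cexp (2 * π * I * τ / 24) ^ 2 := by
    rw [← exp_nat_mul]; congr 1; push_cast; ring
  rw [gaussPhi_eq_eulerProd hτ, eta_eq, eta_eq, h1, h2, mul_pow,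
    mul_div_mul_left _ _ (pow_ne_zero _ (exp_ne_zero _))]

lemma gaussPhi_ne_zero {τ : ℂ} (hτ : 0 < τ.im) : gaussPhi τ ≠ 0 := by
  rw [gaussPhi_eq_eta hτ]
  exact div_ne_zero (pow_ne_zero _ (ModularForm.eta_ne_zero hτ))
    (ModularForm.eta_ne_zero (two_mul_im_pos hτ))

lemma theta2_eq_prod {τ : ℂ} (hτ : 0 < τ.im) :
    theta2 τ = 2 * cexp (π * I * τ / 4) * eulerProd (cexp (2 * π * I * τ)) *
      shiftedProd (cexp (2 * π * I * τ)) (cexp (2 * π * I * τ)) ^ 2 := by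
  have hq1 : ‖cexp (2 * π * I * τ)‖ < 1 := norm_cexp_two_pi_lt_one hτ
  have h2 : cexp (2 * π * I * (τ / 2) + π * I * τ) = cexp (2 * π * I * τ) := by congr 1; ring
  have h3 : cexp (-(2 * π * I * (τ / 2)) + π * I * τ) = 1 := by
    rw [← exp_zero]; congr 1; ring
  rw [theta2, jacobiTheta₂_eq_prod _ hτ, h2, h3, shiftedProd_eq_mul 1 hq1, one_mul]
  ring

lemma theta2_ne_zero {τ : ℂ} (hτ : 0 < τ.im) : theta2 τ ≠ 0 := by
  have hq1 : ‖cexp (2 * π * I * τ)‖ < 1 := norm_cexp_two_pi_lt_one hτ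
  rw [theta2_eq_prod hτ]
  refine mul_ne_zero (mul_ne_zero (mul_ne_zero two_ne_zero (exp_ne_zero _)) (eulerProd_ne_zero hq1))
    (pow_ne_zero _ (shiftedProd_ne_zero hq1 fun k h => ?_))
  rw [← pow_succ'] at h
  have h1 : ‖cexp (2 * π * I * τ) ^ (k + 1)‖ = 1 := by rw [eq_neg_of_add_eq_zero_right h]; simp
  rw [norm_pow] at h1
  exact (pow_lt_one₀ (norm_nonneg _) hq1 (Nat.succ_ne_zero k)).ne h1

lemma jacobiTheta₂_half_period {τ : ℂ} (hτ : 0 < τ.im) : jacobiTheta₂ ((1 + τ) / 2) τ = 0 := by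
  have h3 : cexp (-(2 * π * I * ((1 + τ) / 2)) + π * I * τ) = -1 := by
    rw [show (-(2 * π * I * ((1 + τ) / 2)) + π * I * τ : ℂ) = -(π * I) by ring, exp_neg,
      exp_pi_mul_I]; norm_num
  rw [jacobiTheta₂_eq_prod _ hτ, h3, shiftedProd_eq_mul (-1) (norm_cexp_two_pi_lt_one hτ)]
  simp

/-- Jacobi's derivative formula. -/
lemma jacobiTheta₂'_half_period {τ : ℂ} (hτ : 0 < τ.im) :
    jacobiTheta₂' ((1 + τ) / 2) τ = 2 * π * I * eulerProd (cexp (2 * π * I * τ)) ^ 3 := by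
  set q := cexp (2 * π * I * τ) with hq
  have hq1 : ‖q‖ < 1 := norm_cexp_two_pi_lt_one hτ
  set z₀ : ℂ := (1 + τ) / 2 with hz₀
  have ha : cexp (2 * π * I * z₀ + π * I * τ) = -q := by
    rw [show (2 * π * I * z₀ + π * I * τ : ℂ) = 2 * π * I * τ + π * I by rw [hz₀]; ring, exp_add,
      exp_pi_mul_I]; ring
  have hb : cexp (-(2 * π * I * z₀) + π * I * τ) = -1 := by
    rw [show (-(2 * π * I * z₀) + π * I * τ : ℂ) = -(π * I) by rw [hz₀]; ring, exp_neg,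
      exp_pi_mul_I]; norm_num
  let b : ℂ → ℂ := fun z => cexp (-(2 * π * I * z) + π * I * τ)
  let g : ℂ → ℂ := fun z => eulerProd q *
    (shiftedProd (cexp (2 * π * I * z + π * I * τ)) q * shiftedProd (b z * q) q)
  have hfac (z : ℂ) : jacobiTheta₂ z τ = (1 + b z) * g z := by
    rw [jacobiTheta₂_eq_prod _ hτ, shiftedProd_eq_mul (cexp (-(2 * π * I * z) + π * I * τ)) hq1]
    simp only [g, b]; ring
  have hcont := continuous_shiftedProd hq1
  have hg : Continuous g := by
    refine continuous_const.mul ((hcont.comp (by fun_prop)).mul (hcont.comp ?_))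
    fun_prop
  have hg0 : g z₀ = eulerProd q ^ 3 := by
    simp only [g, b, ha, hb]
    rw [neg_one_mul, ← eulerProd_eq_shiftedProd]; ring
  have hbd : HasDerivAt b (2 * π * I) z₀ := by
    have hlin : HasDerivAt (fun z => -(2 * π * I * z) + π * I * τ) (-(2 * π * I)) z₀ := by
      simpa using ((hasDerivAt_id z₀).const_mul (2 * π * I)).fun_neg.add_const (π * I * τ)
    have h := hlin.cexp
    rw [hb] at h
    convert! h using 1; ring
  have h1 := (hasDerivAt_jacobiTheta₂_fst z₀ hτ)
  refine h1.unique ?_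
  rw [hasDerivAt_iff_tendsto_slope] at hbd ⊢
  -- Since 1 + b vanishes at z₀, the difference quotient of (1 + b) g is the slope of b times g;
  -- continuity of g suffices and no derivative of a product is needed.
  have h2 := hbd.mul ((hg.tendsto z₀).mono_left nhdsWithin_le_nhds)
  rw [hg0] at h2
  refine h2.congr fun z => ?_
  have hbz : b z₀ = -1 := hb
  simp only [slope, hfac, hbz, vsub_eq_sub, smul_eq_mul]
  ring

/-- `∑ (-1)^n (2n+1) x^{(n+1/2)²} = θ₂(τ) θ₄(2τ)²`. -/
lemma hasSum_theta2_mul_gaussPhi_sq {τ : ℂ} (hτ : 0 < τ.im) :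
    HasSum (fun n : ℤ => (-1) ^ n * (2 * n + 1) * cexp (π * I * τ * (n + 1 / 2) ^ 2))
      (theta2 τ * gaussPhi τ ^ 2) := by
  have hq1 : ‖cexp (2 * π * I * τ)‖ < 1 := norm_cexp_two_pi_lt_one hτ
  have hval : theta2 τ * gaussPhi τ ^ 2 =
      cexp (π * I * τ / 4) * ((π * I)⁻¹ * jacobiTheta₂' ((1 + τ) / 2) τ +
        jacobiTheta₂ ((1 + τ) / 2) τ) := by
    have hπ : (π : ℂ) * I ≠ 0 := mul_ne_zero (ofReal_ne_zero.mpr Real.pi_ne_zero) I_ne_zero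
    have h0 := eulerProd_ne_zero hq1
    have h1 : shiftedProd (cexp (2 * π * I * τ)) (cexp (2 * π * I * τ)) ≠ 0 := by
      intro h
      apply theta2_ne_zero hτ
      rw [theta2_eq_prod hτ, h]; simp
    rw [jacobiTheta₂_half_period hτ, jacobiTheta₂'_half_period hτ, gaussPhi_eq_eulerProd hτ,
      theta2_eq_prod hτ, ← shiftedProd_self_mul_eulerProd hq1]
    field_simp
    ring
  rw [hval]
  refine ((((hasSum_jacobiTheta₂'_term _ hτ).mul_left (π * I)⁻¹).add
    (hasSum_jacobiTheta₂_term _ hτ)).mul_left (cexp (π * I * τ / 4))).congr_fun ?_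
  intro n
  have hπ : (π : ℂ) * I ≠ 0 := mul_ne_zero (ofReal_ne_zero.mpr Real.pi_ne_zero) I_ne_zero
  have he : cexp (π * I * τ / 4) * jacobiTheta₂_term n ((1 + τ) / 2) τ =
      (-1) ^ n * cexp (π * I * τ * (n + 1 / 2) ^ 2) := by
    rw [jacobiTheta₂_term, ← cexp_pi_mul_int, ← exp_add, ← exp_add]
    congr 1; ring
  rw [jacobiTheta₂'_term]
  have h2 : ((π : ℂ) * I)⁻¹ * (2 * π * I * n * jacobiTheta₂_term n ((1 + τ) / 2) τ) =
      2 * n * jacobiTheta₂_term n ((1 + τ) / 2) τ := by field_simp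
  rw [h2]
  linear_combination -(2 * n + 1) * he

/-! ### Parity splittings of double series and the degree two relations. -/

section Splitting

variable {ι α : Type*} {F : ι → ℂ} {i j : α → ι} (P : ι → Prop)

/-- A sum over `ι` splits along two injections with complementary ranges. -/
lemma hasSum_of_split {a b : ℂ} (hi : i.Injective) (hj : j.Injective) (hPi : ∀ x, P (i x))
    (hPj : ∀ x, ¬ P (j x)) (hPi' : ∀ y, P y → ∃ x, i x = y) (hPj' : ∀ y, ¬ P y → ∃ x, j x = y)
    (ha : HasSum (F ∘ i) a) (hb : HasSum (F ∘ j) b) : HasSum F (a + b) := by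
  have hr : Set.range i = {y | P y} := by
    ext y; exact ⟨fun ⟨x, hx⟩ => hx ▸ hPi x, hPi' y⟩
  have hc : Set.range j = {y | P y}ᶜ := by
    ext y; exact ⟨fun ⟨x, hx⟩ => hx ▸ hPj x, hPj' y⟩
  refine HasSum.add_isCompl (s := Set.range i) (t := Set.range j) ?_
    (hi.hasSum_range_iff.mpr ha) (hj.hasSum_range_iff.mpr hb)
  rw [hr, hc]
  exact isCompl_compl

lemma tsum_eq_add_of_split (hF : Summable F) (hi : i.Injective) (hj : j.Injective)
    (hPi : ∀ x, P (i x)) (hPj : ∀ x, ¬ P (j x)) (hPi' : ∀ y, P y → ∃ x, i x = y)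
    (hPj' : ∀ y, ¬ P y → ∃ x, j x = y) :
    ∑' y, F y = ∑' x, F (i x) + ∑' x, F (j x) :=
  (hasSum_of_split P hi hj hPi hPj hPi' hPj' (hF.comp_injective hi).hasSum
    (hF.comp_injective hj).hasSum).tsum_eq

end Splitting

lemma hasSum_mul_prod {ι κ : Type*} {f : ι → ℂ} {g : κ → ℂ} {a b : ℂ} (hf : HasSum f a)
    (hg : HasSum g b) : HasSum (fun p : ι × κ => f p.1 * g p.2) (a * b) :=
  hf.mul hg (summable_mul_of_summable_norm hf.summable.norm hg.summable.norm)

/-- Split the index pairs by the parity of their sum and pass to half sum and half difference. The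
degree two relations below are specialisations to half periods. -/
lemma jacobiTheta₂_mul (z w : ℂ) {τ : ℂ} (hτ : 0 < τ.im) :
    jacobiTheta₂ z τ * jacobiTheta₂ w τ =
      jacobiTheta₂ (z + w) (2 * τ) * jacobiTheta₂ (z - w) (2 * τ) +
      cexp (2 * π * I * z + π * I * τ) *
        (jacobiTheta₂ (z + w + τ) (2 * τ) * jacobiTheta₂ (z - w + τ) (2 * τ)) := by
  have h2 := two_mul_im_pos hτ
  refine (hasSum_mul_prod (hasSum_jacobiTheta₂_term z hτ) (hasSum_jacobiTheta₂_term w hτ)).unique ?_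
  refine hasSum_of_split (fun y => Even (y.1 + y.2)) (i := fun x : ℤ × ℤ => (x.1 + x.2, x.1 - x.2))
    (j := fun x : ℤ × ℤ => (x.1 + x.2 + 1, x.1 - x.2)) ?_ ?_ ?_ ?_ ?_ ?_
    ((hasSum_mul_prod (hasSum_jacobiTheta₂_term (z + w) h2)
      (hasSum_jacobiTheta₂_term (z - w) h2)).congr_fun ?_)
    (((hasSum_mul_prod (hasSum_jacobiTheta₂_term (z + w + τ) h2)
      (hasSum_jacobiTheta₂_term (z - w + τ) h2)).mul_left _).congr_fun ?_)
  · rintro ⟨a, b⟩ ⟨c, d⟩ h; simp only [Prod.mk.injEq] at *; omega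
  · rintro ⟨a, b⟩ ⟨c, d⟩ h; simp only [Prod.mk.injEq] at *; omega
  · rintro ⟨a, b⟩; exact ⟨a, by simp⟩
  · rintro ⟨a, b⟩ ⟨c, h⟩; simp only at h; omega
  · rintro ⟨a, b⟩ ⟨c, h⟩; exact ⟨(c, a - c), Prod.ext (by dsimp only at *; omega) (by dsimp only at *; omega)⟩
  · rintro ⟨a, b⟩ h
    obtain ⟨c, h⟩ := Int.not_even_iff_odd.mp h
    exact ⟨(c, c - b), Prod.ext (by dsimp only at *; omega) (by dsimp only at *; omega)⟩
  · rintro ⟨a, b⟩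
    simp only [Function.comp, jacobiTheta₂_term, ← exp_add]
    congr 1; push_cast; ring
  · rintro ⟨a, b⟩
    simp only [Function.comp, jacobiTheta₂_term, ← exp_add]
    congr 1; push_cast; ring

lemma theta2_two_mul_sq (τ : ℂ) :
    theta2 (2 * τ) ^ 2 = cexp (π * I * τ) * jacobiTheta₂ τ (2 * τ) ^ 2 := by
  rw [theta2, mul_pow, ← exp_nat_mul, mul_div_cancel_left₀ τ two_ne_zero]
  congr 2; push_cast; ring

/-- The odd class contributes nothing, because one of its factors is the theta function at its zero.
-/
lemma gaussPhi_sq {τ : ℂ} (hτ : 0 < τ.im) : gaussPhi τ ^ 2 = theta3 τ * theta4 τ := by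
  have h := jacobiTheta₂_mul 0 (1 / 2) hτ
  have h0 : jacobiTheta₂ (0 + 1 / 2 + τ) (2 * τ) = 0 := by
    rw [show (0 + 1 / 2 + τ : ℂ) = (1 + 2 * τ) / 2 by ring,
      jacobiTheta₂_half_period (two_mul_im_pos hτ)]
  rw [h0, zero_sub, jacobiTheta₂_neg_left, zero_add, zero_mul, mul_zero, add_zero] at h
  rw [gaussPhi, theta4, theta3, theta4, h, sq]

lemma theta3_sq {τ : ℂ} (hτ : 0 < τ.im) :
    theta3 τ ^ 2 = theta3 (2 * τ) ^ 2 + theta2 (2 * τ) ^ 2 := by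
  have h := jacobiTheta₂_mul 0 0 hτ
  simp only [add_zero, sub_zero, mul_zero, zero_add] at h
  rw [theta2_two_mul_sq, theta3, theta3]
  linear_combination h

lemma theta4_sq {τ : ℂ} (hτ : 0 < τ.im) :
    theta4 τ ^ 2 = theta3 (2 * τ) ^ 2 - theta2 (2 * τ) ^ 2 := by
  have h := jacobiTheta₂_mul (1 / 2) (1 / 2) hτ
  have h1 : jacobiTheta₂ (1 / 2 + 1 / 2) (2 * τ) = jacobiTheta₂ 0 (2 * τ) := by
    rw [← jacobiTheta₂_add_left 0]; congr 1; norm_num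
  have h2 : jacobiTheta₂ (1 / 2 + 1 / 2 + τ) (2 * τ) = jacobiTheta₂ τ (2 * τ) := by
    rw [← jacobiTheta₂_add_left τ]; congr 1; ring
  have h3 : cexp (2 * π * I * (1 / 2) + π * I * τ) = - cexp (π * I * τ) := by
    rw [show (2 * π * I * (1 / 2) + π * I * τ : ℂ) = π * I * τ + π * I by ring, exp_add,
      exp_pi_mul_I]; ring
  rw [h1, h2, h3, sub_self, zero_add] at h
  rw [theta2_two_mul_sq, theta3, theta4]
  linear_combination h

lemma theta2_sq {τ : ℂ} (hτ : 0 < τ.im) :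
    theta2 τ ^ 2 = 2 * theta2 (2 * τ) * theta3 (2 * τ) := by
  have h := jacobiTheta₂_mul (τ / 2) (τ / 2) hτ
  have h1 : jacobiTheta₂ (τ / 2 + τ / 2 + τ) (2 * τ) =
      cexp (-(2 * π * I * τ)) * jacobiTheta₂ 0 (2 * τ) := by
    rw [show τ / 2 + τ / 2 + τ = 0 + 2 * τ by ring, jacobiTheta₂_add_left']
    congr 2; ring
  have h2 : cexp (2 * π * I * (τ / 2) + π * I * τ) * cexp (-(2 * π * I * τ)) = 1 := by
    rw [← exp_add, ← exp_zero]; congr 1; ring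
  have h3 : theta2 (2 * τ) = cexp (π * I * τ / 4) ^ 2 * jacobiTheta₂ τ (2 * τ) := by
    rw [theta2, mul_div_cancel_left₀ τ two_ne_zero, ← exp_nat_mul]
    congr 2; push_cast; ring
  rw [h1, sub_self, zero_add, add_halves] at h
  rw [h3, theta2, theta3]
  linear_combination cexp (π * I * τ / 4) ^ 2 * h +
    cexp (π * I * τ / 4) ^ 2 * jacobiTheta₂ 0 (2 * τ) * jacobiTheta₂ τ (2 * τ) * h2

/-- Jacobi's quartic identity. -/
lemma theta3_pow_four {τ : ℂ} (hτ : 0 < τ.im) :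
    theta3 τ ^ 4 = theta4 τ ^ 4 + theta2 τ ^ 4 := by
  have h1 := theta3_sq hτ
  have h2 := theta4_sq hτ
  have h3 := theta2_sq hτ
  rw [show 4 = 2 * 2 from rfl, pow_mul, pow_mul, pow_mul, h1, h2, h3]
  ring

/-! ### The binary form of discriminant -7 and the degree seven relation. -/

/-- The theta series of the form `s² + st + 2t²`. -/
noncomputable def theta7 (τ : ℂ) : ℂ :=
  ∑' p : ℤ × ℤ, cexp (π * I * τ * (p.1 ^ 2 + p.1 * p.2 + 2 * p.2 ^ 2))

lemma four_mul_im_pos {τ : ℂ} (hτ : 0 < τ.im) : 0 < (4 * τ).im := by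
  simpa using hτ

lemma seven_mul_im_pos {τ : ℂ} (hτ : 0 < τ.im) : 0 < (7 * τ).im := by
  simpa using hτ

/-- Complete the square: s² + st + 2t² = (s + t/2)² + 7 (t/2)². Even t gives the θ₃ product and odd
t the θ₂ product. -/
lemma hasSum_theta7 {τ : ℂ} (hτ : 0 < τ.im) :
    HasSum (fun p : ℤ × ℤ => cexp (π * I * τ * (p.1 ^ 2 + p.1 * p.2 + 2 * p.2 ^ 2)))
      (theta3 τ * theta3 (7 * τ) + theta2 τ * theta2 (7 * τ)) := by
  have h7 := seven_mul_im_pos hτ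
  refine hasSum_of_split (fun y => Even y.2) (i := fun x : ℤ × ℤ => (x.1 - x.2, 2 * x.2))
    (j := fun x : ℤ × ℤ => (x.1 - x.2, 2 * x.2 + 1)) ?_ ?_ ?_ ?_ ?_ ?_
    ((hasSum_mul_prod (hasSum_theta3 hτ) (hasSum_theta3 h7)).congr_fun ?_)
    ((hasSum_mul_prod (hasSum_theta2 hτ) (hasSum_theta2 h7)).congr_fun ?_)
  · rintro ⟨a, b⟩ ⟨c, d⟩ h; simp only [Prod.mk.injEq] at *; omega
  · rintro ⟨a, b⟩ ⟨c, d⟩ h; simp only [Prod.mk.injEq] at *; omega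
  · rintro ⟨a, b⟩; exact ⟨b, by dsimp only; omega⟩
  · rintro ⟨a, b⟩ ⟨c, h⟩; simp only at h; omega
  · rintro ⟨a, b⟩ ⟨c, h⟩; exact ⟨(a + c, c), Prod.ext (by dsimp only at *; omega) (by dsimp only at *; omega)⟩
  · rintro ⟨a, b⟩ h
    obtain ⟨c, h⟩ := Int.not_even_iff_odd.mp h
    exact ⟨(a + c, c), Prod.ext (by dsimp only at *; omega) (by dsimp only at *; omega)⟩
  · rintro ⟨a, b⟩
    simp only [Function.comp, ← exp_add]
    congr 1; push_cast; ring
  · rintro ⟨a, b⟩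
    simp only [Function.comp, ← exp_add]
    congr 1; push_cast; ring

lemma theta7_eq {τ : ℂ} (hτ : 0 < τ.im) :
    theta7 τ = theta3 τ * theta3 (7 * τ) + theta2 τ * theta2 (7 * τ) :=
  (hasSum_theta7 hτ).tsum_eq

lemma summable_theta7 {τ : ℂ} (hτ : 0 < τ.im) :
    Summable (fun p : ℤ × ℤ => cexp (π * I * τ * (p.1 ^ 2 + p.1 * p.2 + 2 * p.2 ^ 2))) :=
  (hasSum_theta7 hτ).summable

/-- The coefficient 1 + (-1)^(x+y) keeps the pairs x ≡ y modulo 2, on which x² + 7y² is four times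
the binary form. -/
lemma theta3_mul_add_theta4_mul {τ : ℂ} (hτ : 0 < τ.im) :
    theta3 τ * theta3 (7 * τ) + theta4 τ * theta4 (7 * τ) = 2 * theta7 (4 * τ) := by
  have h7 := seven_mul_im_pos hτ
  have h3 := hasSum_mul_prod (hasSum_theta3 hτ) (hasSum_theta3 h7)
  have h4 := hasSum_mul_prod (hasSum_theta4 hτ) (hasSum_theta4 h7)
  have h := h3.add h4
  have h' := (summable_theta7 (four_mul_im_pos hτ)).hasSum.mul_left 2
  have hi : (fun x : ℤ × ℤ => (2 * x.1 + x.2, x.2)).Injective := by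
    rintro ⟨a, b⟩ ⟨c, d⟩ h; simp only [Prod.mk.injEq] at *; omega
  refine h.unique ((hi.hasSum_iff ?_).mp (h'.congr_fun ?_))
  · rintro ⟨a, b⟩ hab
    have hodd : Odd (a + b) := by
      rw [← Int.not_even_iff_odd]
      rintro ⟨c, hc⟩
      exact hab ⟨(c - b, b), Prod.ext (by dsimp only at *; omega) rfl⟩
    have hs : ((-1 : ℂ) ^ a) * (-1) ^ b = -1 := by
      rw [← zpow_add₀ (by norm_num)]; exact hodd.neg_one_zpow
    simp only
    linear_combination cexp (π * I * τ * a ^ 2) * cexp (π * I * (7 * τ) * b ^ 2) * hs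
  · rintro ⟨a, b⟩
    have hs : ((-1 : ℂ) ^ (2 * a + b)) * (-1) ^ b = 1 := by
      rw [← zpow_add₀ (by norm_num)]
      exact Even.neg_one_zpow ⟨a + b, by ring⟩
    have he : cexp (π * I * (4 * τ) * (a ^ 2 + a * b + 2 * b ^ 2)) =
        cexp (π * I * τ * ((2 * a + b : ℤ) : ℂ) ^ 2) * cexp (π * I * (7 * τ) * b ^ 2) := by
      rw [← exp_add]; congr 1; push_cast; ring
    simp only [Function.comp, he]
    linear_combination cexp (π * I * τ * ((2 * a + b : ℤ) : ℂ) ^ 2) *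
      cexp (π * I * (7 * τ) * b ^ 2) * hs

/-- In `theta7 (2 * τ)` the pairs with s even reproduce `theta7 (4 * τ)`. The pairs with s odd give
half of the θ₂ product, whose two parity classes are exchanged by x ↦ -1 - x. -/
lemma theta2_mul_eq {τ : ℂ} (hτ : 0 < τ.im) :
    theta2 τ * theta2 (7 * τ) = 2 * (theta7 (2 * τ) - theta7 (4 * τ)) := by
  have h7 := seven_mul_im_pos hτ
  have h2 := hasSum_mul_prod (hasSum_theta2 hτ) (hasSum_theta2 h7)
  have hS2 := summable_theta7 (two_mul_im_pos hτ)
  have hS : theta7 (2 * τ) = theta7 (4 * τ) + ∑' p : ℤ × ℤ, cexp (π * I * (2 * τ) *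
      (((2 * p.2 + 1 : ℤ) : ℂ) ^ 2 + ((2 * p.2 + 1 : ℤ) : ℂ) * p.1 + 2 * p.1 ^ 2)) := by
    rw [theta7, tsum_eq_add_of_split (fun y => Even y.1) hS2
      (i := fun x : ℤ × ℤ => (2 * x.2, x.1)) (j := fun x : ℤ × ℤ => (2 * x.2 + 1, x.1)), theta7]
    · congr 1
      refine tsum_congr fun p => ?_
      congr 1; push_cast; ring
    · rintro ⟨a, b⟩ ⟨c, d⟩ h; simp only [Prod.mk.injEq] at *; omega
    · rintro ⟨a, b⟩ ⟨c, d⟩ h; simp only [Prod.mk.injEq] at *; omega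
    · rintro ⟨a, b⟩; exact ⟨b, by dsimp only; omega⟩
    · rintro ⟨a, b⟩ ⟨c, h⟩; simp only at h; omega
    · rintro ⟨a, b⟩ ⟨c, h⟩; exact ⟨(b, c), Prod.ext (by dsimp only at *; omega) rfl⟩
    · rintro ⟨a, b⟩ h
      obtain ⟨c, h⟩ := Int.not_even_iff_odd.mp h
      exact ⟨(b, c), Prod.ext (by dsimp only at *; omega) rfl⟩
  rw [hS, add_sub_cancel_left, ← h2.tsum_eq, tsum_eq_add_of_split (fun y => Even (y.1 - y.2))
    h2.summable (i := fun x : ℤ × ℤ => (2 * x.1 + x.2, x.2))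
    (j := fun x : ℤ × ℤ => (-(2 * x.1) - x.2 - 1, x.2)), two_mul]
  · congr 1
    all_goals
      refine tsum_congr fun p => ?_
      rw [← exp_add]
      congr 1; push_cast; ring
  · rintro ⟨a, b⟩ ⟨c, d⟩ h; simp only [Prod.mk.injEq] at *; omega
  · rintro ⟨a, b⟩ ⟨c, d⟩ h; simp only [Prod.mk.injEq] at *; omega
  · rintro ⟨a, b⟩; exact ⟨a, by dsimp only; omega⟩
  · rintro ⟨a, b⟩ ⟨c, h⟩; simp only at h; omega
  · rintro ⟨a, b⟩ ⟨c, h⟩; exact ⟨(c, b), Prod.ext (by dsimp only at *; omega) rfl⟩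
  · rintro ⟨a, b⟩ h
    obtain ⟨c, h⟩ := Int.not_even_iff_odd.mp h
    exact ⟨(-c - b - 1, b), Prod.ext (by dsimp only at *; omega) rfl⟩

/-- The modular equation of degree seven, in terms of theta constants. -/
lemma theta3_mul_sub_gaussPhi_mul {τ : ℂ} (hτ : 0 < τ.im) :
    theta3 τ * theta3 (7 * τ) - gaussPhi τ * gaussPhi (7 * τ) =
      theta2 (τ / 2) * theta2 (7 * τ / 2) / 2 := by
  have hh : 0 < (τ / 2).im := by
    rw [show τ / 2 = ((1 / 2 : ℝ) : ℂ) * τ by push_cast; ring, Complex.im_ofReal_mul]; positivity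
  have h2 := two_mul_im_pos hτ
  have e1 := theta2_mul_eq hh
  have e2 := theta2_mul_eq hτ
  have e3 := theta2_mul_eq h2
  have e4 := theta3_mul_add_theta4_mul h2
  have e5 := theta7_eq hτ
  have e6 := theta7_eq h2
  rw [show 7 * (τ / 2) = 7 * τ / 2 by ring, show 2 * (τ / 2) = τ by ring,
    show 4 * (τ / 2) = 2 * τ by ring] at e1
  rw [show 2 * (2 * τ) = 4 * τ by ring, show 4 * (2 * τ) = 8 * τ by ring] at e3
  rw [show 4 * (2 * τ) = 8 * τ by ring] at e4
  rw [gaussPhi, gaussPhi, show 2 * (7 * τ) = 7 * (2 * τ) by ring]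
  -- All values of `theta7` at τ, 2τ, 4τ, 8τ, and the θ₂ and θ₃ products at 2τ, are eliminated
  -- linearly.
  linear_combination (-1 / 2) * e1 - e3 - e2 - e4 - e5 - e6

/-! ### The index-seven sublattices and averaging over seventh roots of unity. -/

/-- The points `(τ + 8 j) / 7`, which with `7 τ` run over the index-seven sublattices. -/
noncomputable def heckePoint (τ : ℂ) (j : ℕ) : ℂ := (τ + 8 * j) / 7

lemma heckePoint_im_pos {τ : ℂ} (hτ : 0 < τ.im) (j : ℕ) : 0 < (heckePoint τ j).im := by
  have : (heckePoint τ j).im = τ.im / 7 := by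
    rw [heckePoint, show ((τ + 8 * j) / 7 : ℂ) = ((1 / 7 : ℝ) : ℂ) * τ + ((8 * j / 7 : ℝ) : ℂ) by
      push_cast; ring, Complex.add_im, Complex.im_ofReal_mul, Complex.ofReal_im]
    ring
  rw [this]; positivity

lemma sum_root_of_unity_pow (M : ℤ) :
    ∑ j ∈ Finset.range 7, cexp (2 * π * I * (j * M / 7)) = if (7 : ℤ) ∣ M then 7 else 0 := by
  have hterm (j : ℕ) : cexp (2 * π * I * (j * M / 7)) = cexp (2 * π * I * (M / 7)) ^ j := by
    rw [← exp_nat_mul]; congr 1; ring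
  simp only [hterm]
  split_ifs with h
  · obtain ⟨k, rfl⟩ := h
    have h1 : cexp (2 * π * I * (((7 * k : ℤ) : ℂ) / 7)) = 1 := by
      rw [exp_eq_one_iff]; exact ⟨k, by push_cast; ring⟩
    simp only [h1, one_pow]; simp
  · have h1 : cexp (2 * π * I * (M / 7)) ≠ 1 := by
      intro h1
      obtain ⟨n, hn⟩ := exp_eq_one_iff.mp h1
      apply h
      refine ⟨n, ?_⟩
      have hπ : (2 * π * I : ℂ) ≠ 0 := two_pi_I_ne_zero
      have h2 : (M : ℂ) = 7 * n := by
        have : (2 * π * I : ℂ) * (M / 7) = (2 * π * I) * n := by rw [hn]; ring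
        have := mul_left_cancel₀ hπ this
        field_simp at this
        linear_combination this
      exact_mod_cast h2
    rw [geom_sum_eq h1, ← exp_nat_mul]
    have h2 : cexp ((7 : ℕ) * (2 * π * I * (M / 7))) = 1 := by
      rw [exp_eq_one_iff]; exact ⟨M, by push_cast; ring⟩
    rw [h2, sub_self, zero_div]

/-- Summing over j keeps the terms with 7 ∣ (2a+1)² + 8b². As -1 is not a square modulo 7, both 2a+1
and b are then multiples of 7, that is a = 7x + 3 and b = 7y, and the surviving series lives at 7τ.
-/
lemma sum_theta2_mul_gaussPhi {τ : ℂ} (hτ : 0 < τ.im) :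
    ∑ j ∈ Finset.range 7, theta2 (heckePoint τ j) * gaussPhi (heckePoint τ j) =
      7 * (theta2 (7 * τ) * gaussPhi (7 * τ)) := by
  have h7 := seven_mul_im_pos hτ
  have hL := hasSum_sum (s := Finset.range 7) fun j _ => hasSum_mul_prod
    (hasSum_theta2 (heckePoint_im_pos hτ j)) (hasSum_theta4 (two_mul_im_pos (heckePoint_im_pos hτ j)))
  have hR := (hasSum_mul_prod (hasSum_theta2 h7) (hasSum_theta4 (two_mul_im_pos h7))).mul_left 7
  have hterm (p : ℤ × ℤ) : ∑ j ∈ Finset.range 7,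
      cexp (π * I * heckePoint τ j * (p.1 + 1 / 2) ^ 2) *
        ((-1) ^ p.2 * cexp (π * I * (2 * heckePoint τ j) * p.2 ^ 2)) =
      (-1) ^ p.2 * cexp (π * I * (τ / 7) * ((p.1 + 1 / 2) ^ 2 + 2 * p.2 ^ 2)) *
        if (7 : ℤ) ∣ (2 * p.1 + 1) ^ 2 + 8 * p.2 ^ 2 then 7 else 0 := by
    rw [← sum_root_of_unity_pow, Finset.mul_sum]
    refine Finset.sum_congr rfl fun j _ => ?_
    rw [mul_left_comm, ← exp_add, mul_assoc ((-1 : ℂ) ^ p.2), ← exp_add]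
    congr 2
    rw [heckePoint]; push_cast; ring
  have hi : (fun x : ℤ × ℤ => (7 * x.1 + 3, 7 * x.2)).Injective := by
    rintro ⟨a, b⟩ ⟨c, d⟩ h; simp only [Prod.mk.injEq] at *; omega
  refine hL.unique ((hi.hasSum_iff ?_).mp (hR.congr_fun ?_))
  · rintro ⟨a, b⟩ hab
    rw [hterm, if_neg, mul_zero]
    intro hdvd
    have hz : ∀ x y : ZMod 7, (2 * x + 1) ^ 2 + 8 * y ^ 2 = 0 → x = 3 ∧ y = 0 := by decide
    have h0 : ((2 * (a : ZMod 7) + 1) ^ 2 + 8 * (b : ZMod 7) ^ 2) = 0 := by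
      have := (ZMod.intCast_zmod_eq_zero_iff_dvd ((2 * a + 1) ^ 2 + 8 * b ^ 2) 7).mpr hdvd
      push_cast at this
      exact this
    obtain ⟨ha, hb⟩ := hz _ _ h0
    have ha' : (7 : ℤ) ∣ a - 3 :=
      (ZMod.intCast_zmod_eq_zero_iff_dvd (a - 3) 7).mp (by push_cast; rw [ha]; decide)
    have hb' : (7 : ℤ) ∣ b := (ZMod.intCast_zmod_eq_zero_iff_dvd b 7).mp hb
    obtain ⟨c, hc⟩ := ha'
    obtain ⟨d, hd⟩ := hb'
    exact hab ⟨(c, d), Prod.ext (by dsimp only; omega) (by dsimp only; omega)⟩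
  · rintro ⟨a, b⟩
    have hs : ((-1 : ℂ)) ^ (7 * b) = (-1) ^ b := by
      rw [zpow_mul]; norm_num
    have h := hterm (7 * a + 3, 7 * b)
    dsimp only at h
    simp only [Function.comp]
    rw [h, if_pos ⟨7 * ((2 * a + 1) ^ 2 + 8 * b ^ 2), by ring⟩, hs, mul_left_comm (cexp _),
      ← exp_add, mul_comm (7 : ℂ) ((-1) ^ b * _)]
    congr 3
    push_cast; ring

/-! ### The quotients u = θ₃/φ, w = θ₂/φ and their degree seven equations. -/

/-- The quotient `θ₃(τ) / θ₄(2τ)`. -/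
noncomputable def thetaRatio (τ : ℂ) : ℂ := theta3 τ / gaussPhi τ

/-- The quotient `θ₂(τ) / θ₄(2τ)`. -/
noncomputable def thetaRatio' (τ : ℂ) : ℂ := theta2 τ / gaussPhi τ

lemma theta3_ne_zero {τ : ℂ} (hτ : 0 < τ.im) : theta3 τ ≠ 0 := by
  intro h
  have h1 := gaussPhi_sq hτ
  rw [h, zero_mul] at h1
  exact gaussPhi_ne_zero hτ (pow_eq_zero_iff two_ne_zero |>.mp h1)

lemma thetaRatio_ne_zero {τ : ℂ} (hτ : 0 < τ.im) : thetaRatio τ ≠ 0 :=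
  div_ne_zero (theta3_ne_zero hτ) (gaussPhi_ne_zero hτ)

lemma thetaRatio'_ne_zero {τ : ℂ} (hτ : 0 < τ.im) : thetaRatio' τ ≠ 0 :=
  div_ne_zero (theta2_ne_zero hτ) (gaussPhi_ne_zero hτ)

lemma thetaRatio_inv {τ : ℂ} (hτ : 0 < τ.im) : (thetaRatio τ)⁻¹ = theta4 τ / gaussPhi τ := by
  have h1 := gaussPhi_sq hτ
  have h2 := gaussPhi_ne_zero hτ
  have h3 := theta3_ne_zero hτ
  rw [thetaRatio, inv_div, div_eq_div_iff h3 h2]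
  linear_combination h1

lemma thetaRatio'_pow_four {τ : ℂ} (hτ : 0 < τ.im) :
    thetaRatio' τ ^ 4 = thetaRatio τ ^ 4 - (thetaRatio τ)⁻¹ ^ 4 := by
  have h1 := theta3_pow_four hτ
  rw [thetaRatio_inv hτ, thetaRatio', thetaRatio, div_pow, div_pow, div_pow, h1]
  ring

lemma half_im_pos {τ : ℂ} (hτ : 0 < τ.im) : 0 < (τ / 2).im := by
  rw [show τ / 2 = ((1 / 2 : ℝ) : ℂ) * τ by push_cast; ring, Complex.im_ofReal_mul]; positivity

lemma theta2_half_sq {τ : ℂ} (hτ : 0 < τ.im) :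
    theta2 (τ / 2) ^ 2 = 2 * theta2 τ * theta3 τ := by
  rw [theta2_sq (half_im_pos hτ), mul_div_cancel₀ τ two_ne_zero]

/-- Makes u⁸ - 1 an eighth power up to a constant, so that the eighth power of
`thetaRatio_mul_sub_one` factors as the modular equation, with 2⁸ = 16². -/
lemma thetaRatio_pow_eight_sub_one {τ : ℂ} (hτ : 0 < τ.im) :
    thetaRatio τ ^ 8 - 1 = (theta2 (τ / 2) / gaussPhi τ) ^ 8 / 16 := by
  have h1 := theta3_pow_four hτ
  have h2 := gaussPhi_ne_zero hτ
  have h3 := theta2_half_sq hτ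
  have h4 := gaussPhi_sq hτ
  have h5 : theta2 (τ / 2) ^ 8 = 16 * theta2 τ ^ 4 * theta3 τ ^ 4 := by
    rw [show 8 = 2 * 4 from rfl, pow_mul, h3]; ring
  have h6 : gaussPhi τ ^ 8 = theta3 τ ^ 4 * theta4 τ ^ 4 := by
    rw [show 8 = 2 * 4 from rfl, pow_mul, h4]; ring
  rw [thetaRatio, div_pow, div_pow, h5, div_sub_one (pow_ne_zero _ h2), h6]
  have h7 : theta3 τ ^ 8 = theta3 τ ^ 4 * (theta4 τ ^ 4 + theta2 τ ^ 4) := by rw [← h1]; ring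
  rw [h7]
  ring

lemma thetaRatio_mul_sub_one {τ : ℂ} (hτ : 0 < τ.im) :
    thetaRatio τ * thetaRatio (7 * τ) - 1 =
      (theta2 (τ / 2) / gaussPhi τ) * (theta2 (7 * τ / 2) / gaussPhi (7 * τ)) / 2 := by
  have h2 := gaussPhi_ne_zero hτ
  have h3 := gaussPhi_ne_zero (seven_mul_im_pos hτ)
  have h := theta3_mul_sub_gaussPhi_mul hτ
  rw [thetaRatio, thetaRatio]
  field_simp
  linear_combination 2 * h

/-- The modular equation of degree seven `(1 - u⁸)(1 - v⁸) = (1 - uv)⁸`. -/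
lemma thetaRatio_modular_equation {τ : ℂ} (hτ : 0 < τ.im) :
    (thetaRatio τ * thetaRatio (7 * τ) - 1) ^ 8 =
      (thetaRatio τ ^ 8 - 1) * (thetaRatio (7 * τ) ^ 8 - 1) := by
  rw [thetaRatio_mul_sub_one hτ, thetaRatio_pow_eight_sub_one hτ,
    thetaRatio_pow_eight_sub_one (seven_mul_im_pos hτ)]
  ring

/-- Squaring `thetaRatio_mul_sub_one` and using θ₂(τ/2)² = 2 θ₂ θ₃ gives (uv - 1)² = ww' uv; then
divide by uv. -/
lemma thetaRatio'_mul {τ : ℂ} (hτ : 0 < τ.im) :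
    thetaRatio' τ * thetaRatio' (7 * τ) =
      thetaRatio τ * thetaRatio (7 * τ) - 2 + (thetaRatio τ)⁻¹ * (thetaRatio (7 * τ))⁻¹ := by
  have h7 := seven_mul_im_pos hτ
  have hu := thetaRatio_ne_zero hτ
  have hv := thetaRatio_ne_zero h7
  have h1 : (thetaRatio τ * thetaRatio (7 * τ) - 1) ^ 2 =
      thetaRatio' τ * thetaRatio' (7 * τ) * (thetaRatio τ * thetaRatio (7 * τ)) := by
    rw [thetaRatio_mul_sub_one hτ, div_pow, mul_pow, div_pow, div_pow, theta2_half_sq hτ,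
      theta2_half_sq h7, thetaRatio', thetaRatio', thetaRatio, thetaRatio]
    ring
  field_simp
  linear_combination -h1

lemma theta3_add_eight_mul (τ : ℂ) (j : ℕ) : theta3 (τ + 8 * j) = theta3 τ := by
  have h : Function.Periodic theta3 2 := fun τ => jacobiTheta₂_add_right 0 τ
  have := h.nat_mul (4 * j) τ
  rw [← this]; congr 1; push_cast; ring

lemma gaussPhi_add_nat (τ : ℂ) (j : ℕ) : gaussPhi (τ + j) = gaussPhi τ := by
  have h : Function.Periodic gaussPhi 1 := fun τ => by
    rw [gaussPhi, gaussPhi, mul_add, mul_one]; exact jacobiTheta₂_add_right (1 / 2) (2 * τ)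
  have := h.nat_mul j τ
  rw [← this, mul_one]

/-- The prefactor e^{πiτ/4} has period 8, which dictates the translation by 8j in `heckePoint`:
multiplying such a point by 7 must give back the quotients at τ. -/
lemma theta2_add_eight_mul (τ : ℂ) (j : ℕ) : theta2 (τ + 8 * j) = theta2 τ := by
  have h : Function.Periodic theta2 8 := fun τ => by
    have h1 : cexp (π * I * (τ + 8) / 4) = cexp (π * I * τ / 4) := by
      rw [show π * I * (τ + 8) / 4 = π * I * τ / 4 + 2 * π * I by ring, exp_add, exp_two_pi_mul_I,
        mul_one]
    rw [theta2, theta2, h1, show (τ + 8) / 2 = τ / 2 + 1 + 1 + 1 + 1 by ring,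
      show τ + 8 = τ + 2 + 2 + 2 + 2 by ring]
    simp only [jacobiTheta₂_add_left, jacobiTheta₂_add_right]
  have := h.nat_mul j τ
  rw [← this]; congr 1; ring

lemma seven_mul_heckePoint (τ : ℂ) (j : ℕ) : 7 * heckePoint τ j = τ + 8 * j := by
  rw [heckePoint]; ring

lemma gaussPhi_add_eight_mul (τ : ℂ) (j : ℕ) : gaussPhi (τ + 8 * j) = gaussPhi τ := by
  have := gaussPhi_add_nat τ (8 * j)
  push_cast at this
  exact this

lemma thetaRatio_seven_mul_heckePoint (τ : ℂ) (j : ℕ) :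
    thetaRatio (7 * heckePoint τ j) = thetaRatio τ := by
  rw [seven_mul_heckePoint, thetaRatio, theta3_add_eight_mul, gaussPhi_add_eight_mul, thetaRatio]

lemma thetaRatio'_seven_mul_heckePoint (τ : ℂ) (j : ℕ) :
    thetaRatio' (7 * heckePoint τ j) = thetaRatio' τ := by
  rw [seven_mul_heckePoint, thetaRatio', theta2_add_eight_mul, gaussPhi_add_eight_mul, thetaRatio']

/-! ### Vieta for the modular equation, and separation of its roots near the cusp. -/

open Polynomial in
/-- The sum of the eight roots `v` of the modular equation of degree seven. -/
lemma sum_roots_modular_equation {ι : Type*} [Fintype ι] (hcard : Fintype.card ι = 8) (u : ℂ)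
    {v : ι → ℂ} (hv : v.Injective) (h : ∀ i, (u * v i - 1) ^ 8 = (u ^ 8 - 1) * (v i ^ 8 - 1)) :
    ∑ i, v i = 8 * u ^ 7 := by
  classical
  -- The expansion of (uX - 1)⁸ - (u⁸ - 1)(X⁸ - 1), which is monic because the u⁸ terms cancel in
  -- the top coefficient.
  let p : ℂ[X] := X ^ 8 + C (-(8 * u ^ 7)) * X ^ 7 + C (28 * u ^ 6) * X ^ 6 +
    C (-(56 * u ^ 5)) * X ^ 5 + C (70 * u ^ 4) * X ^ 4 + C (-(56 * u ^ 3)) * X ^ 3 +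
    C (28 * u ^ 2) * X ^ 2 + C (-(8 * u)) * X + C (u ^ 8)
  let r : ℂ[X] := ∏ i, (X - C (v i))
  have hpd : p.degree = 8 := by simp only [p]; compute_degree!
  have hpm : p.Monic := by simp only [p]; monicity!
  have hrm : r.Monic := monic_prod_of_monic _ _ fun i _ => monic_X_sub_C _
  have hrd : r.degree = 8 := by
    rw [degree_eq_natDegree hrm.ne_zero, natDegree_finsetProd_X_sub_C_eq_card, Finset.card_univ,
      hcard]; rfl
  have himg : (Finset.univ.image v).card = 8 := by
    rw [Finset.card_image_of_injective _ hv, Finset.card_univ, hcard]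
  have hpr : p = r := by
    refine eq_of_degree_sub_lt_of_eval_finset_eq (Finset.univ.image v) ?_ ?_
    · rw [himg]
      refine (degree_sub_lt_left (hpd.trans hrd.symm) hpm.ne_zero ?_).trans_eq hpd
      rw [hpm.leadingCoeff, hrm.leadingCoeff]
    · intro x hx
      obtain ⟨i, -, rfl⟩ := Finset.mem_image.mp hx
      have hr0 : r.eval (v i) = 0 := by
        rw [eval_prod]
        exact Finset.prod_eq_zero (Finset.mem_univ i) (by simp)
      rw [hr0]
      simp only [p, eval_add, eval_mul, eval_pow, eval_X, eval_C]
      linear_combination h i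
  have hc := congrArg (fun f : ℂ[X] => f.coeff 7) hpr
  have hrc : r.coeff 7 = -∑ i, v i := by
    have := prod_X_sub_C_coeff_card_pred (Finset.univ : Finset ι) v
      (by rw [Finset.card_univ, hcard]; norm_num)
    rwa [Finset.card_univ, hcard] at this
  have hpc : p.coeff 7 = -(8 * u ^ 7) := by
    simp [p, coeff_X_pow, -map_mul, -map_neg, -map_pow, coeff_C_mul]
  simp only [hpc, hrc] at hc
  exact (neg_injective hc).symm

/-- The series `∑ c(n) x^{n²}` as a function of `x`. -/
noncomputable def squareSeries (c : ℤ → ℂ) (x : ℂ) : ℂ := ∑' n : ℤ, c n * x ^ (n.natAbs ^ 2)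

lemma summable_half_pow_sq : Summable fun n : ℤ => ((1 / 2 : ℝ)) ^ (n.natAbs ^ 2) := by
  have h : Summable fun n : ℕ => ((1 / 2 : ℝ)) ^ (n ^ 2) :=
    (summable_geometric_of_lt_one (by norm_num) (by norm_num : (1 / 2 : ℝ) < 1)).of_nonneg_of_le
      (fun n => by positivity) fun n => pow_le_pow_of_le_one (by norm_num) (by norm_num)
        (Nat.le_self_pow two_ne_zero n)
  exact Summable.of_nat_of_neg (by simpa using h) (by simpa using h)

lemma squareSeries_zero (c : ℤ → ℂ) : squareSeries c 0 = c 0 := by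
  unfold squareSeries
  rw [tsum_eq_single 0]
  · simp
  · intro n hn
    rw [zero_pow (by positivity), mul_zero]

section

variable {c : ℤ → ℂ} (hc : ∀ n, ‖c n‖ ≤ 1)
include hc

lemma norm_squareSeries_term_le (n : ℤ) (x : ℂ) (hx : x ∈ Metric.ball (0 : ℂ) (1 / 2)) :
    ‖c n * x ^ (n.natAbs ^ 2)‖ ≤ (1 / 2 : ℝ) ^ (n.natAbs ^ 2) := by
  rw [norm_mul, norm_pow]
  have hx' : ‖x‖ ≤ 1 / 2 := (mem_ball_zero_iff.mp hx).le
  calc ‖c n‖ * ‖x‖ ^ (n.natAbs ^ 2) ≤ 1 * (1 / 2) ^ (n.natAbs ^ 2) := by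
        gcongr; exact hc n
    _ = _ := one_mul _

lemma differentiableOn_squareSeries :
    DifferentiableOn ℂ (squareSeries c) (Metric.ball 0 (1 / 2)) :=
  differentiableOn_tsum_of_summable_norm summable_half_pow_sq (fun n => by fun_prop)
    Metric.isOpen_ball (norm_squareSeries_term_le hc)

lemma deriv_squareSeries_zero : deriv (squareSeries c) 0 = c 1 + c (-1) := by
  have h := hasSum_deriv_of_summable_norm summable_half_pow_sq
    (fun n => by fun_prop) Metric.isOpen_ball (norm_squareSeries_term_le hc)
    (Metric.mem_ball_self (by norm_num : (0 : ℝ) < 1 / 2))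
  refine h.unique ?_
  have h2 : ∑ n ∈ ({1, -1} : Finset ℤ), deriv (fun x : ℂ => c n * x ^ (n.natAbs ^ 2)) 0 =
      c 1 + c (-1) := by
    rw [Finset.sum_pair (by norm_num)]
    simp
  rw [← h2]
  refine hasSum_sum_of_ne_finset_zero fun n hn => ?_
  have hn1 : n.natAbs ≠ 1 := by
    simp only [Finset.mem_insert, Finset.mem_singleton] at hn
    omega
  have hn2 : n.natAbs ^ 2 - 1 ≠ 0 ∨ n.natAbs ^ 2 = 0 := by
    rcases Nat.eq_zero_or_pos n.natAbs with h0 | h0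
    · right; rw [h0]; rfl
    · left
      have : 2 ≤ n.natAbs := by omega
      have : 2 ^ 2 ≤ n.natAbs ^ 2 := Nat.pow_le_pow_left this 2
      omega
  rw [deriv_const_mul_field, deriv_pow_field]
  rcases hn2 with h0 | h0
  · rw [zero_pow h0]; simp
  · rw [h0]; simp

end

lemma cexp_pow_natAbs_sq (τ : ℂ) (n : ℤ) :
    cexp (π * I * τ) ^ (n.natAbs ^ 2) = cexp (π * I * τ * n ^ 2) := by
  rw [← exp_nat_mul]
  congr 1
  have : ((n.natAbs ^ 2 : ℕ) : ℂ) = (n : ℂ) ^ 2 := by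
    have h : ((n.natAbs ^ 2 : ℕ) : ℤ) = n ^ 2 := by push_cast; exact sq_abs n
    rw [← Int.cast_natCast, h]; push_cast; rfl
  rw [this]; ring

lemma theta3_eq_squareSeries {τ : ℂ} (hτ : 0 < τ.im) :
    theta3 τ = squareSeries (fun _ => 1) (cexp (π * I * τ)) := by
  rw [← (hasSum_theta3 hτ).tsum_eq, squareSeries]
  simp only [one_mul, cexp_pow_natAbs_sq]

lemma gaussPhi_eq_squareSeries {τ : ℂ} (hτ : 0 < τ.im) :
    gaussPhi τ = squareSeries (fun n => (-1) ^ n) (cexp (π * I * τ) ^ 2) := by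
  have h2 : cexp (π * I * τ) ^ 2 = cexp (π * I * (2 * τ)) := by
    rw [← exp_nat_mul]; congr 1; push_cast; ring
  rw [gaussPhi, ← (hasSum_theta4 (two_mul_im_pos hτ)).tsum_eq, squareSeries, h2]
  simp only [cexp_pow_natAbs_sq]

/-- The quotient `θ₃(τ) / θ₄(2τ)` determines the nome when the latter is small. -/
lemma exists_thetaRatio_injective : ∃ ρ > 0, ∀ τ σ : ℂ, 0 < τ.im → 0 < σ.im →
    ‖cexp (π * I * τ)‖ < ρ → ‖cexp (π * I * σ)‖ < ρ → thetaRatio τ = thetaRatio σ →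
    cexp (π * I * τ) = cexp (π * I * σ) := by
  have hc3 : ∀ n : ℤ, ‖(fun _ : ℤ => (1 : ℂ)) n‖ ≤ 1 := fun n => by simp
  have hc4 : ∀ n : ℤ, ‖(fun n : ℤ => (-1 : ℂ) ^ n) n‖ ≤ 1 := fun n => by simp
  have hb : Metric.ball (0 : ℂ) (1 / 2) ∈ 𝓝 (0 : ℂ) := Metric.ball_mem_nhds _ (by norm_num)
  have hs3 := ((differentiableOn_squareSeries hc3).analyticAt hb).hasStrictDerivAt
  have hs4 := ((differentiableOn_squareSeries hc4).analyticAt hb).hasStrictDerivAt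
  rw [deriv_squareSeries_zero hc3] at hs3
  have hsq : HasStrictDerivAt (fun x : ℂ => x ^ 2) 0 (0 : ℂ) := by
    simpa using hasStrictDerivAt_pow 2 (0 : ℂ)
  have hs4' : HasStrictDerivAt (squareSeries fun n => (-1 : ℂ) ^ n)
      (deriv (squareSeries fun n => (-1 : ℂ) ^ n) 0) ((fun x : ℂ => x ^ 2) 0) := by
    simpa using hs4
  have hden := hs4'.comp (0 : ℂ) hsq
  rw [mul_zero] at hden
  have h0 : squareSeries (fun n => (-1 : ℂ) ^ n) ((0 : ℂ) ^ 2) = 1 := by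
    rw [zero_pow two_ne_zero, squareSeries_zero, zpow_zero]
  have hq := hs3.fun_div hden (by simp only [Function.comp, h0]; exact one_ne_zero)
  simp only [Function.comp, h0] at hq
  have hne : ((1 + 1) * 1 - squareSeries (fun _ => 1) 0 * 0) / (1 : ℂ) ^ 2 ≠ 0 := by norm_num
  -- As a function of the nome the quotient has derivative 2 at 0: the terms n = ±1 of θ₃ contribute
  -- 2, and the denominator depends only on the square of the nome.
  have hinj := hq.eventually_left_inverse hne
  obtain ⟨ρ, hρ, hρ'⟩ := Metric.eventually_nhds_iff_ball.mp hinj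
  refine ⟨ρ, hρ, fun τ σ hτ hσ h1 h2 h => ?_⟩
  have e1 := hρ' _ (mem_ball_zero_iff.mpr h1)
  have e2 := hρ' _ (mem_ball_zero_iff.mpr h2)
  rw [thetaRatio, thetaRatio, theta3_eq_squareSeries hτ, theta3_eq_squareSeries hσ,
    gaussPhi_eq_squareSeries hτ, gaussPhi_eq_squareSeries hσ] at h
  rw [← e1, ← e2, h]

lemma norm_nome (τ : ℂ) : ‖cexp (π * I * τ)‖ = Real.exp (-π * τ.im) := by
  rw [norm_exp]; congr 1; simp

/-- The values of a function at the eight index-seven sublattices. -/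
noncomputable def heckeValue (f : ℂ → ℂ) (τ : ℂ) : Option (Fin 7) → ℂ
  | none => f (7 * τ)
  | some j => f (heckePoint τ j)

lemma sum_heckeValue (f : ℂ → ℂ) (τ : ℂ) :
    ∑ i, heckeValue f τ i = f (7 * τ) + ∑ j ∈ Finset.range 7, f (heckePoint τ j) := by
  rw [Fintype.sum_option, Finset.sum_range]
  rfl

lemma heckePoint_im (τ : ℂ) (j : ℕ) : (heckePoint τ j).im = τ.im / 7 := by
  rw [heckePoint, show ((τ + 8 * j) / 7 : ℂ) = ((1 / 7 : ℝ) : ℂ) * τ + ((8 * j / 7 : ℝ) : ℂ) by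
    push_cast; ring, Complex.add_im, Complex.im_ofReal_mul, Complex.ofReal_im]
  ring

lemma nome_heckePoint_injective (τ : ℂ) {j k : ℕ} (hj : j < 7) (hk : k < 7)
    (h : cexp (π * I * heckePoint τ j) = cexp (π * I * heckePoint τ k)) : j = k := by
  obtain ⟨n, hn⟩ := exp_eq_exp_iff_exists_int.mp h
  have hπ : (π : ℂ) * I ≠ 0 := mul_ne_zero (ofReal_ne_zero.mpr Real.pi_ne_zero) I_ne_zero
  have h1 : heckePoint τ j = heckePoint τ k + 2 * n := by
    apply mul_left_cancel₀ hπ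
    rw [hn]; ring
  rw [heckePoint, heckePoint] at h1
  have h2 : (4 * j : ℂ) = 4 * k + 7 * n := by linear_combination 7 / 2 * h1
  have h3 : (4 * j : ℤ) = 4 * k + 7 * n := by exact_mod_cast h2
  omega

/-- Vieta needs eight distinct roots. High in the half-plane all eight nomes are small, so the
quotient determines the nome; the nome at 7τ has a different modulus from the others, and those
seven differ by distinct seventh roots of unity. -/
lemma exists_heckeValue_injective :
    ∃ Y > 0, ∀ τ : ℂ, Y ≤ τ.im → (heckeValue thetaRatio τ).Injective := by
  obtain ⟨ρ, hρ, hinj⟩ := exists_thetaRatio_injective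
  have hlim : Tendsto (fun y : ℝ => Real.exp (-π * (y / 7))) atTop (𝓝 0) := by
    refine Real.tendsto_exp_atBot.comp ?_
    exact (tendsto_id.atTop_div_const (by norm_num : (0 : ℝ) < 7)).const_mul_atTop_of_neg
      (neg_lt_zero.mpr Real.pi_pos)
  obtain ⟨Y₀, hY⟩ := eventually_atTop.mp (hlim.eventually (gt_mem_nhds hρ))
  refine ⟨max Y₀ 1, by positivity, fun τ hτ => ?_⟩
  have hτ0 : 0 < τ.im := lt_of_lt_of_le one_pos ((le_max_right _ _).trans hτ)
  have h7 := seven_mul_im_pos hτ0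
  have hsmall := hY τ.im ((le_max_left _ _).trans hτ)
  have h7im : (7 * τ).im = 7 * τ.im := by simp
  have hj (j : ℕ) : ‖cexp (π * I * heckePoint τ j)‖ < ρ := by
    rw [norm_nome, heckePoint_im]; exact hsmall
  have hinf : ‖cexp (π * I * (7 * τ))‖ < ρ := by
    refine lt_of_le_of_lt ?_ hsmall
    rw [norm_nome, h7im]
    refine Real.exp_le_exp.mpr ?_
    nlinarith [Real.pi_pos]
  have hdiff (j : ℕ) : thetaRatio (7 * τ) ≠ thetaRatio (heckePoint τ j) := by
    intro h
    have h1 := congrArg norm (hinj _ _ h7 (heckePoint_im_pos hτ0 j) hinf (hj j) h)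
    rw [norm_nome, norm_nome, heckePoint_im, h7im] at h1
    have h2 := Real.exp_injective h1
    have h3 := mul_left_cancel₀ (neg_ne_zero.mpr Real.pi_ne_zero) h2
    linarith
  rintro (_ | j) (_ | k) h
  · rfl
  · exact absurd h (hdiff k)
  · exact absurd h.symm (hdiff j)
  · congr 1
    exact Fin.ext (nome_heckePoint_injective τ j.2 k.2
      (hinj _ _ (heckePoint_im_pos hτ0 j) (heckePoint_im_pos hτ0 k) (hj j) (hj k) h))

/-! ### Sums of the quotients over the eight points. -/

section Sums

variable {τ : ℂ} (hτ : 0 < τ.im)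
include hτ

lemma heckeValue_thetaRatio_ne_zero (i : Option (Fin 7)) : heckeValue thetaRatio τ i ≠ 0 := by
  rcases i with _ | j
  · exact thetaRatio_ne_zero (seven_mul_im_pos hτ)
  · exact thetaRatio_ne_zero (heckePoint_im_pos hτ j)

lemma heckeValue_modular_equation (i : Option (Fin 7)) :
    (thetaRatio τ * heckeValue thetaRatio τ i - 1) ^ 8 =
      (thetaRatio τ ^ 8 - 1) * (heckeValue thetaRatio τ i ^ 8 - 1) := by
  rcases i with _ | j
  · exact thetaRatio_modular_equation hτ
  · have h := thetaRatio_modular_equation (heckePoint_im_pos hτ j)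
    rw [thetaRatio_seven_mul_heckePoint] at h
    simp only [heckeValue]
    linear_combination h

lemma heckeValue_thetaRatio'_mul (i : Option (Fin 7)) :
    thetaRatio' τ * heckeValue thetaRatio' τ i =
      thetaRatio τ * heckeValue thetaRatio τ i - 2 +
        (thetaRatio τ)⁻¹ * (heckeValue thetaRatio τ i)⁻¹ := by
  rcases i with _ | j
  · exact thetaRatio'_mul hτ
  · have h := thetaRatio'_mul (heckePoint_im_pos hτ j)
    rw [thetaRatio_seven_mul_heckePoint, thetaRatio'_seven_mul_heckePoint] at h
    simp only [heckeValue]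
    linear_combination h

variable (hinj : (heckeValue thetaRatio τ).Injective)
include hinj

lemma sum_heckeValue_thetaRatio : ∑ i, heckeValue thetaRatio τ i = 8 * thetaRatio τ ^ 7 :=
  sum_roots_modular_equation (by simp) _ hinj (heckeValue_modular_equation hτ)

/-- The modular equation is invariant under inverting both u and v. -/
lemma sum_heckeValue_thetaRatio_inv :
    ∑ i, (heckeValue thetaRatio τ i)⁻¹ = 8 * (thetaRatio τ)⁻¹ ^ 7 := by
  refine sum_roots_modular_equation (by simp) _ (inv_injective.comp hinj) fun i => ?_
  have h := heckeValue_modular_equation hτ i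
  have h1 := thetaRatio_ne_zero hτ
  have h2 := heckeValue_thetaRatio_ne_zero hτ i
  field_simp
  linear_combination h

/-- Summing `heckeValue_thetaRatio'_mul` gives w ∑ w' = 8u⁸ - 16 + 8u⁻⁸ = 8 (u⁴ - u⁻⁴)², and u⁴ -
u⁻⁴ = w⁴. -/
lemma sum_heckeValue_thetaRatio' : ∑ i, heckeValue thetaRatio' τ i = 8 * thetaRatio' τ ^ 7 := by
  have hw := thetaRatio'_ne_zero hτ
  have hu := thetaRatio_ne_zero hτ
  apply mul_left_cancel₀ hw
  rw [Finset.mul_sum, Finset.sum_congr rfl fun i _ => heckeValue_thetaRatio'_mul hτ i,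
    Finset.sum_add_distrib, Finset.sum_sub_distrib, ← Finset.mul_sum, ← Finset.mul_sum,
    sum_heckeValue_thetaRatio hτ hinj, sum_heckeValue_thetaRatio_inv hτ hinj, Finset.sum_const,
    Finset.card_univ, show Fintype.card (Option (Fin 7)) = 8 by simp]
  have h4 := thetaRatio'_pow_four hτ
  have h5 : thetaRatio' τ * (8 * thetaRatio' τ ^ 7) = 8 * (thetaRatio' τ ^ 4) ^ 2 := by ring
  rw [h5, h4]
  field_simp
  ring

end Sums

/-! ### Independence of the four theta pairings for small nome. -/

lemma summable_one_add_abs_mul_half_pow_sq :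
    Summable fun n : ℤ => (1 + |(n : ℝ)|) * (1 / 2 : ℝ) ^ (n.natAbs ^ 2) := by
  have h : Summable fun n : ℕ => (1 + (n : ℝ)) * (1 / 2 : ℝ) ^ (n ^ 2) := by
    have h1 : Summable fun n : ℕ => (1 + (n : ℝ)) * (1 / 2 : ℝ) ^ n := by
      simp only [add_mul, one_mul]
      refine (summable_geometric_of_lt_one (by norm_num) (by norm_num)).add ?_
      simpa using summable_pow_mul_geometric_of_norm_lt_one 1
        (by norm_num : ‖(1 / 2 : ℝ)‖ < 1)
    refine h1.of_nonneg_of_le (fun n => by positivity) fun n => ?_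
    gcongr ?_ * ?_
    exact pow_le_pow_of_le_one (by norm_num) (by norm_num) (Nat.le_self_pow two_ne_zero n)
  exact Summable.of_nat_of_neg (by simpa using h) (by simpa using h)

/-- In a vanishing sum with rapidly decreasing terms, the leading terms are small. -/
lemma norm_leading_sum_le {f : ℤ → ℂ} (hf : HasSum f 0) (S : Finset ℤ) {e : ℤ → ℕ} {w : ℤ → ℝ}
    {M R : ℝ} (hM : 0 ≤ M) (hR : 0 ≤ R) (hR2 : R ≤ 1 / 2) (hw : ∀ n, 0 ≤ w n) (N : ℕ)
    (hbound : ∀ n, ‖f n‖ ≤ M * (w n * R ^ e n)) (hN : ∀ n ∉ S, f n = 0 ∨ N ≤ e n)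
    (hs : Summable fun n => w n * (1 / 2 : ℝ) ^ e n) :
    ‖∑ n ∈ S, f n‖ ≤ M * ((2 * R) ^ N * ∑' n, w n * (1 / 2 : ℝ) ^ e n) := by
  have h1 : HasSum (fun n => if n ∈ S then f n else 0) (∑ n ∈ S, f n) := by
    rw [← Finset.sum_congr rfl fun n (hn : n ∈ S) => if_pos (c := n ∈ S) (e := (0 : ℂ)) hn]
    exact hasSum_sum_of_ne_finset_zero fun n hn => if_neg hn
  have h2 := h1.sub hf
  rw [sub_zero] at h2
  rw [← h2.tsum_eq]
  refine tsum_of_norm_bounded ((hs.hasSum.mul_left _).mul_left M) fun n => ?_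
  have hpos : 0 ≤ M * ((2 * R) ^ N * (w n * (1 / 2 : ℝ) ^ e n)) := by
    have := hw n; positivity
  by_cases hn : n ∈ S
  · simpa [hn] using hpos
  · simp only [if_neg hn, zero_sub, norm_neg]
    rcases hN n hn with h0 | h0
    · rw [h0, norm_zero]; exact hpos
    · refine (hbound n).trans (mul_le_mul_of_nonneg_left ?_ hM)
      -- Of the factor (2R)^(e n) only N powers are kept; the remaining (1/2)^(e n) makes the
      -- majorant summable independently of R.
      have h3 : R ^ e n ≤ (2 * R) ^ N * (1 / 2 : ℝ) ^ e n := by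
        have h4 : R ^ e n = (2 * R) ^ e n * (1 / 2 : ℝ) ^ e n := by
          rw [← mul_pow]; congr 1; ring
        rw [h4]
        gcongr ?_ * _
        exact pow_le_pow_of_le_one (by positivity) (by linarith) h0
      calc w n * R ^ e n ≤ w n * ((2 * R) ^ N * (1 / 2 : ℝ) ^ e n) :=
            mul_le_mul_of_nonneg_left h3 (hw n)
        _ = _ := by ring

lemma eq_of_dvd_sub {D : ℤ → ℂ} (hper : ∀ m, D (m + 7) = D m) {a b : ℤ} (h : (7 : ℤ) ∣ a - b) :
    D a = D b := by
  have hp : Function.Periodic D 7 := hper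
  obtain ⟨k, hk⟩ := h
  have := hp.int_mul k b
  rw [← this]; congr 1
  simp only [Int.cast_id]; linarith

lemma eq_one_of_representatives {D : ℤ → ℂ} (hper : ∀ m, D (m + 7) = D m)
    (heven : ∀ m, D (-m) = D m) (m : ℤ) : D m = D 0 ∨ D m = D 1 ∨ D m = D 2 ∨ D m = D 3 := by
  have h : m % 7 = 0 ∨ m % 7 = 1 ∨ m % 7 = 2 ∨ m % 7 = 3 ∨ m % 7 = 4 ∨ m % 7 = 5 ∨ m % 7 = 6 := by
    omega
  rcases h with h | h | h | h | h | h | h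
  · exact .inl (eq_of_dvd_sub hper (by omega))
  · exact .inr (.inl (eq_of_dvd_sub hper (by omega)))
  · exact .inr (.inr (.inl (eq_of_dvd_sub hper (by omega))))
  · exact .inr (.inr (.inr (eq_of_dvd_sub hper (by omega))))
  · exact .inr (.inr (.inr ((heven m).symm.trans (eq_of_dvd_sub hper (by omega)))))
  · exact .inr (.inr (.inl ((heven m).symm.trans (eq_of_dvd_sub hper (by omega)))))
  · exact .inr (.inl ((heven m).symm.trans (eq_of_dvd_sub hper (by omega))))

/-- An even function on `ℤ/7` is determined by its pairings with four theta series. -/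
lemma exists_eq_zero_of_theta_relations : ∃ ρ > 0, ∀ ξ : ℂ, ξ ≠ 0 → ‖ξ‖ < ρ → ∀ D : ℤ → ℂ,
    (∀ m, D (m + 7) = D m) → (∀ m, D (-m) = D m) →
    HasSum (fun m => D m * ξ ^ ((2 * m).natAbs ^ 2)) 0 →
    HasSum (fun m => (-1) ^ m * D m * ξ ^ ((2 * m).natAbs ^ 2)) 0 →
    HasSum (fun m => D m * ξ ^ ((2 * m + 7).natAbs ^ 2)) 0 →
    HasSum (fun m => (-1) ^ m * (2 * m + 7) * D m * ξ ^ ((2 * m + 7).natAbs ^ 2)) 0 →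
    ∀ m, D m = 0 := by
  let k₁ : ℤ → ℝ := fun m => 2 * (1 / 2 : ℝ) ^ ((2 * m).natAbs ^ 2)
  let k₂ : ℤ → ℝ := fun m => (1 + |((2 * m + 7 : ℤ) : ℝ)|) * (1 / 2 : ℝ) ^ ((2 * m + 7).natAbs ^ 2)
  have hs₁ : Summable k₁ := by
    have hi : Function.Injective fun m : ℤ => 2 * m := fun a b h => by dsimp only at h; omega
    exact (summable_half_pow_sq.comp_injective hi).mul_left 2
  have hs₂ : Summable k₂ := by
    have hi : Function.Injective fun m : ℤ => 2 * m + 7 := fun a b h => by dsimp only at h; omega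
    exact summable_one_add_abs_mul_half_pow_sq.comp_injective hi
  have hk₁ : 0 ≤ ∑' m, k₁ m := tsum_nonneg fun m => by positivity
  have hk₂ : 0 ≤ ∑' m, k₂ m := tsum_nonneg fun m => by positivity
  set K := ∑' m, k₁ m + ∑' m, k₂ m with hK
  have hK0 : 0 ≤ K := add_nonneg hk₁ hk₂
  -- Here 70 = 1 + 4 + 64 + 1 is the sum of the constants in the final bounds for D 0, …, D 3, and
  -- the added 2 keeps 2‖ξ‖ below 1.
  refine ⟨1 / (2 * (70 * K + 2)), by positivity, ?_⟩
  intro ξ hξ hξρ D hper heven hA hB hC hD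
  set R := ‖ξ‖ with hRdef
  have hR0 : 0 < R := norm_pos_iff.mpr hξ
  have hT : 2 * R * (70 * K + 2) < 1 := by
    rw [lt_div_iff₀ (by positivity)] at hξρ
    linarith
  have hR2 : R ≤ 1 / 2 := by nlinarith
  set T := 2 * R with hTdef
  have hT0 : 0 < T := by positivity
  have hT1 : T ≤ 1 := by linarith
  set M := ‖D 0‖ + ‖D 1‖ + ‖D 2‖ + ‖D 3‖ with hM
  have hM0 : 0 ≤ M := by positivity
  have hDM (m : ℤ) : ‖D m‖ ≤ M := by
    have := norm_nonneg (D 0); have := norm_nonneg (D 1)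
    have := norm_nonneg (D 2); have := norm_nonneg (D 3)
    rcases eq_one_of_representatives hper heven m with h | h | h | h <;> rw [h] <;> linarith
  have hsgn (m : ℤ) : ‖(-1 : ℂ) ^ m‖ = 1 := by simp
  have e1 : D (-1) = D 1 := heven 1
  have e2 : D (-2) = D 2 := heven 2
  have e3 : D (-3) = D 3 := heven 3
  have e4 : D (-4) = D 3 := eq_of_dvd_sub hper (by norm_num)
  have e5 : D (-5) = D 2 := eq_of_dvd_sub hper (by norm_num)
  have hw₂ (m : ℤ) : 0 ≤ 1 + |((2 * m + 7 : ℤ) : ℝ)| := by positivity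
  have hpow (n N : ℕ) (h : N ≤ n) : N ^ 2 ≤ n ^ 2 := Nat.pow_le_pow_left h 2
  -- The sum of the first two relations keeps even m: m = 0 leads and m = ±2, of exponent 16,
  -- follows.
  have b0 : 2 * ‖D 0‖ ≤ M * (T ^ 16 * ∑' m, k₁ m) := by
    have hAB := hA.add hB
    rw [add_zero] at hAB
    have h : ‖∑ m ∈ {0}, (D m * ξ ^ ((2 * m).natAbs ^ 2) +
        (-1) ^ m * D m * ξ ^ ((2 * m).natAbs ^ 2))‖ ≤ M * (T ^ 16 * ∑' m, k₁ m) :=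
      norm_leading_sum_le hAB {0} (e := fun m => (2 * m).natAbs ^ 2) (w := fun _ => 2) hM0 hR0.le
        hR2 (fun _ => zero_le_two) 16 (fun m => ?_) (fun m hm => ?_) hs₁
    · have hsum : ∑ m ∈ ({0} : Finset ℤ), (D m * ξ ^ ((2 * m).natAbs ^ 2) +
          (-1) ^ m * D m * ξ ^ ((2 * m).natAbs ^ 2)) = 2 * D 0 := by
        rw [Finset.sum_singleton]; norm_num; ring
      rwa [hsum, norm_mul, Complex.norm_two] at h
    · rw [show D m * ξ ^ ((2 * m).natAbs ^ 2) + (-1) ^ m * D m * ξ ^ ((2 * m).natAbs ^ 2) =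
        D m * ((1 + (-1) ^ m) * ξ ^ ((2 * m).natAbs ^ 2)) by ring, norm_mul, norm_mul, norm_pow]
      gcongr
      · exact hDM m
      · refine (norm_add_le _ _).trans ?_
        rw [hsgn, norm_one]; norm_num
    · rcases Int.even_or_odd m with hp | hp
      · right
        obtain ⟨c, rfl⟩ := hp
        exact hpow _ 4 (by simp only [Finset.mem_singleton] at hm; omega)
      · left
        rw [hp.neg_one_zpow]; ring
  -- Their difference keeps odd m: the leading exponent is 4 at m = ±1 and the next is 36.
  have b1 : 4 * (‖D 1‖ * R ^ 4) ≤ M * (T ^ 36 * ∑' m, k₁ m) := by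
    have hAB := hA.sub hB
    rw [sub_zero] at hAB
    have h : ‖∑ m ∈ {1, -1}, (D m * ξ ^ ((2 * m).natAbs ^ 2) -
        (-1) ^ m * D m * ξ ^ ((2 * m).natAbs ^ 2))‖ ≤ M * (T ^ 36 * ∑' m, k₁ m) :=
      norm_leading_sum_le hAB {1, -1} (e := fun m => (2 * m).natAbs ^ 2) (w := fun _ => 2) hM0
        hR0.le hR2 (fun _ => zero_le_two) 36 (fun m => ?_) (fun m hm => ?_) hs₁
    · have hsum : ∑ m ∈ ({1, -1} : Finset ℤ), (D m * ξ ^ ((2 * m).natAbs ^ 2) -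
          (-1) ^ m * D m * ξ ^ ((2 * m).natAbs ^ 2)) = 4 * (D 1 * ξ ^ 4) := by
        rw [Finset.sum_pair (by norm_num), e1]; norm_num; ring
      rw [hsum, norm_mul, norm_mul, norm_pow] at h
      simpa only [Complex.norm_ofNat] using h
    · rw [show D m * ξ ^ ((2 * m).natAbs ^ 2) - (-1) ^ m * D m * ξ ^ ((2 * m).natAbs ^ 2) =
        D m * ((1 - (-1) ^ m) * ξ ^ ((2 * m).natAbs ^ 2)) by ring, norm_mul, norm_mul, norm_pow]
      gcongr
      · exact hDM m
      · refine (norm_sub_le _ _).trans ?_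
        rw [hsgn, norm_one]; norm_num
    · rcases Int.even_or_odd m with hp | hp
      · left
        rw [hp.neg_one_zpow]; ring
      · right
        obtain ⟨c, rfl⟩ := hp
        exact hpow _ 6 (by simp only [Finset.mem_insert, Finset.mem_singleton] at hm; omega)
  -- In the sum of the last two relations the coefficient 1 + (-1)^m (2m+7) vanishes at m = -3, -4,
  -- which removes D 3; the leading exponent is 9 at m = -2, -5, where the coefficient is 4, and the
  -- next is 25.
  have b2 : 8 * (‖D 2‖ * R ^ 9) ≤ M * (T ^ 25 * ∑' m, k₂ m) := by
    have hCD := hC.add hD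
    rw [add_zero] at hCD
    have h : ‖∑ m ∈ {-2, -5}, (D m * ξ ^ ((2 * m + 7).natAbs ^ 2) +
        (-1) ^ m * (2 * m + 7) * D m * ξ ^ ((2 * m + 7).natAbs ^ 2))‖ ≤
        M * (T ^ 25 * ∑' m, k₂ m) :=
      norm_leading_sum_le hCD {-2, -5} (e := fun m => (2 * m + 7).natAbs ^ 2)
        (w := fun m => 1 + |((2 * m + 7 : ℤ) : ℝ)|) hM0 hR0.le hR2 hw₂ 25
        (fun m => ?_) (fun m hm => ?_) hs₂
    · have hsum : ∑ m ∈ ({-2, -5} : Finset ℤ), (D m * ξ ^ ((2 * m + 7).natAbs ^ 2) +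
          (-1) ^ m * (2 * m + 7) * D m * ξ ^ ((2 * m + 7).natAbs ^ 2)) = 8 * (D 2 * ξ ^ 9) := by
        have s5 : (-1 : ℂ) ^ (-5 : ℤ) = -1 := Odd.neg_one_zpow (by decide)
        have s2 : (-1 : ℂ) ^ (-2 : ℤ) = 1 := Even.neg_one_zpow (by decide)
        rw [Finset.sum_pair (by norm_num), e2, e5, s5, s2]; norm_num; ring
      rw [hsum, norm_mul, norm_mul, norm_pow] at h
      simpa only [Complex.norm_ofNat] using h
    · rw [show D m * ξ ^ ((2 * m + 7).natAbs ^ 2) +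
        (-1) ^ m * (2 * m + 7) * D m * ξ ^ ((2 * m + 7).natAbs ^ 2) =
        D m * ((1 + (-1) ^ m * (2 * m + 7)) * ξ ^ ((2 * m + 7).natAbs ^ 2)) by ring, norm_mul,
        norm_mul, norm_pow]
      gcongr
      · exact hDM m
      · refine (norm_add_le _ _).trans ?_
        rw [norm_mul, hsgn, norm_one, one_mul, ← Complex.norm_intCast]
        push_cast; rfl
    · have hm' : m ≠ -3 ∧ m ≠ -4 ∨ (m = -3 ∨ m = -4) := by omega
      simp only [Finset.mem_insert, Finset.mem_singleton] at hm
      rcases hm' with hm' | rfl | rfl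
      · exact .inr (hpow _ 5 (by omega))
      · left
        rw [show (-1 : ℂ) ^ (-3 : ℤ) = -1 from Odd.neg_one_zpow (by decide)]; push_cast; ring
      · left
        rw [show (-1 : ℂ) ^ (-4 : ℤ) = 1 from Even.neg_one_zpow (by decide)]; push_cast; ring
  -- The third relation alone leads with exponent 1 at m = -3, -4; all other exponents are at least
  -- 9.
  have b3 : 2 * (‖D 3‖ * R) ≤ M * (T ^ 9 * ∑' m, k₂ m) := by
    have h : ‖∑ m ∈ {-3, -4}, (D m * ξ ^ ((2 * m + 7).natAbs ^ 2))‖ ≤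
        M * (T ^ 9 * ∑' m, k₂ m) :=
      norm_leading_sum_le hC {-3, -4} (e := fun m => (2 * m + 7).natAbs ^ 2)
        (w := fun m => 1 + |((2 * m + 7 : ℤ) : ℝ)|) hM0 hR0.le hR2 hw₂ 9
        (fun m => ?_) (fun m hm => ?_) hs₂
    · have hsum : ∑ m ∈ ({-3, -4} : Finset ℤ), (D m * ξ ^ ((2 * m + 7).natAbs ^ 2)) =
          2 * (D 3 * ξ) := by
        rw [Finset.sum_pair (by norm_num), e3, e4]; norm_num; ring
      rw [hsum, norm_mul, norm_mul] at h
      simpa only [Complex.norm_ofNat] using h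
    · rw [norm_mul, norm_pow]
      gcongr
      · exact hDM m
      · refine le_mul_of_one_le_left (by positivity) ?_
        linarith [abs_nonneg ((2 * m + 7 : ℤ) : ℝ)]
    · simp only [Finset.mem_insert, Finset.mem_singleton] at hm
      exact .inr (hpow _ 3 (by omega))
  have hTpow (n : ℕ) : T ^ (n + 1) ≤ T := by
    simpa using pow_le_pow_of_le_one hT0.le hT1 (Nat.le_add_left 1 n)
  have hRT : R = T / 2 := by rw [hTdef]; ring
  have hstep {d x : ℝ} (a n : ℕ) (hx : 0 ≤ x) (h : d * T ^ a ≤ x * T ^ (a + (n + 1))) :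
      d ≤ x * T := by
    rw [pow_add, mul_left_comm, mul_comm (T ^ a)] at h
    exact (le_of_mul_le_mul_right h (by positivity)).trans (mul_le_mul_of_nonneg_left (hTpow n) hx)
  have c0 : ‖D 0‖ ≤ M * K * T := by
    refine hstep 0 15 (by positivity) ?_
    have : M * T ^ 16 * ∑' m, k₁ m ≤ M * T ^ 16 * K := by
      gcongr; linarith
    have := norm_nonneg (D 0)
    rw [pow_zero, mul_one]
    norm_num
    linarith
  have c1 : ‖D 1‖ ≤ 4 * M * K * T := by
    refine hstep 4 31 (by positivity) ?_
    have : M * T ^ 36 * ∑' m, k₁ m ≤ M * T ^ 36 * K := by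
      gcongr; linarith
    rw [hRT] at b1
    norm_num
    linarith
  have c2 : ‖D 2‖ ≤ 64 * M * K * T := by
    refine hstep 9 15 (by positivity) ?_
    have : M * T ^ 25 * ∑' m, k₂ m ≤ M * T ^ 25 * K := by
      gcongr; linarith
    rw [hRT] at b2
    norm_num
    linarith
  have c3 : ‖D 3‖ ≤ M * K * T := by
    refine hstep 1 7 (by positivity) ?_
    have : M * T ^ 9 * ∑' m, k₂ m ≤ M * T ^ 9 * K := by
      gcongr; linarith
    rw [hRT] at b3
    norm_num
    linarith
  -- M is the sum of the four norms, so the bounds give M ≤ 70KT · M with 70KT < 1, forcing M = 0.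
  have hMle : M ≤ M * (70 * K * T) := by
    have : M ≤ M * K * T + 4 * M * K * T + 64 * M * K * T + M * K * T := by linarith
    linarith
  have hM1 : M = 0 := by
    by_contra hne
    have hMpos : 0 < M := lt_of_le_of_ne hM0 (Ne.symm hne)
    have : 1 ≤ 70 * K * T := by
      by_contra hlt
      push Not at hlt
      nlinarith
    nlinarith
  intro m
  exact norm_le_zero_iff.mp ((hDM m).trans_eq hM1)

/-! ### Decomposition of ℤ⁷ into cosets of A₆. -/

lemma hasSum_pi_prod {k : ℕ} {g : Fin k → ℤ → ℂ} {a : Fin k → ℂ}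
    (h : ∀ i, HasSum (g i) (a i)) : HasSum (fun n : Fin k → ℤ => ∏ i, g i (n i)) (∏ i, a i) := by
  induction k with
  | zero =>
    simp only [Finset.univ_eq_empty, Finset.prod_empty]
    exact hasSum_unique (fun _ : Fin 0 → ℤ => (1 : ℂ))
  | succ k ih =>
    have h1 := ih fun i : Fin k => h i.succ
    have h2 := hasSum_mul_prod (h 0) h1
    rw [Fin.prod_univ_succ]
    let e : ℤ × (Fin k → ℤ) ≃ (Fin (k + 1) → ℤ) := Fin.consEquiv fun _ => ℤ
    have he : (fun n : Fin (k + 1) → ℤ => ∏ i, g i (n i)) ∘ e =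
        fun p => g 0 p.1 * ∏ i : Fin k, g i.succ (p.2 i) := by
      funext p
      rw [Function.comp_apply, Fin.prod_univ_succ]
      rfl
    rw [← he] at h2
    exact (Equiv.hasSum_iff e).mp h2

/-- The integral vectors of length seven and coordinate sum `m`. -/
abbrev SumFiber (m : ℤ) : Type := {n : Fin 7 → ℤ // ∑ i, n i = m}

lemma SumFiber.cast_eq {m : ℤ} (n : SumFiber m) : (m : ℂ) = ∑ i, (n.1 i : ℂ) := by
  have h := congrArg (Int.cast : ℤ → ℂ) n.2
  push_cast at h
  exact h.symm

/-- The summand of the theta function of a coset of `A₆`. -/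
noncomputable def fiberTerm (τ : ℂ) (m : ℤ) (n : SumFiber m) : ℂ :=
  cexp (π * I * τ * (∑ i, (n.1 i : ℂ) ^ 2 - m ^ 2 / 7))

/-- The theta function of the coset of `A₆` consisting of the vectors `n - (m/7, …, m/7)` with
`n` integral of coordinate sum `m`. -/
noncomputable def fiberTheta (τ : ℂ) (m : ℤ) : ℂ := ∑' n : SumFiber m, fiberTerm τ m n

lemma prod_jacobiTheta₂_term (w τ : ℂ) (m : ℤ) (n : SumFiber m) :
    ∏ i, jacobiTheta₂_term (n.1 i) w τ =
      cexp (2 * π * I * w * m + π * I * τ * (m ^ 2 / 7)) * fiberTerm τ m n := by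
  have hm := n.cast_eq
  simp only [jacobiTheta₂_term]
  rw [← exp_sum, fiberTerm, ← exp_add]
  congr 1
  rw [Finset.sum_add_distrib]
  have h1 : ∑ i, 2 * π * I * (n.1 i : ℂ) * w = 2 * π * I * w * m := by
    rw [hm, Finset.mul_sum]; exact Finset.sum_congr rfl fun i _ => by ring
  have h2 : ∑ i, π * I * (n.1 i : ℂ) ^ 2 * τ = π * I * τ * ∑ i, (n.1 i : ℂ) ^ 2 := by
    rw [Finset.mul_sum]; exact Finset.sum_congr rfl fun i _ => by ring
  rw [h1, h2]; ring

section Decomposition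

variable {τ : ℂ} (hτ : 0 < τ.im)
include hτ

lemma summable_fiberTerm (m : ℤ) : Summable (fiberTerm τ m) := by
  have h := (hasSum_pi_prod fun _ : Fin 7 => hasSum_jacobiTheta₂_term 0 hτ).summable
  have h2 := h.comp_injective (Subtype.val_injective (p := fun n : Fin 7 → ℤ => ∑ i, n i = m))
  simp only [Function.comp_def, prod_jacobiTheta₂_term] at h2
  exact (summable_mul_left_iff (exp_ne_zero _)).mp h2

/-- Group ℤ⁷ by coordinate sum. The weight F, a function of that sum only, is there for the factor
2m + 7 of the derivative relation. -/
lemma hasSum_fiberTheta {F : ℤ → ℂ} {w S : ℂ}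
    (h : HasSum (fun n : Fin 7 → ℤ => F (∑ i, n i) * ∏ i, jacobiTheta₂_term (n i) w τ) S) :
    HasSum (fun m : ℤ => F m * cexp (2 * π * I * w * m + π * I * τ * (m ^ 2 / 7)) *
      fiberTheta τ m) S := by
  have h1 := ((Equiv.sigmaFiberEquiv fun n : Fin 7 → ℤ => ∑ i, n i).hasSum_iff).mpr h
  refine h1.sigma fun m => ?_
  have h2 := (summable_fiberTerm hτ m).hasSum.mul_left
    (F m * cexp (2 * π * I * w * m + π * I * τ * (m ^ 2 / 7)))
  refine h2.congr_fun fun n => ?_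
  have h3 := prod_jacobiTheta₂_term w τ m n
  simp only [Function.comp, Equiv.sigmaFiberEquiv, Equiv.coe_fn_mk]
  rw [n.2, h3]; ring

lemma hasSum_fiberTheta_one (w : ℂ) :
    HasSum (fun m : ℤ => cexp (2 * π * I * w * m + π * I * τ * (m ^ 2 / 7)) * fiberTheta τ m)
      (jacobiTheta₂ w τ ^ 7) := by
  have h := hasSum_pi_prod fun _ : Fin 7 => hasSum_jacobiTheta₂_term w hτ
  rw [Finset.prod_const, Finset.card_univ, Fintype.card_fin] at h
  have := hasSum_fiberTheta hτ (F := fun _ => 1) (by simpa using h)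
  simpa using this

/-- A derivative of a seventh power at a zero, done termwise: 2m + 7 = ∑ (2 n_i + 1), and each
summand yields a product in which the other six factors are the vanishing theta value. -/
lemma hasSum_fiberTheta_half_period :
    HasSum (fun m : ℤ => (2 * m + 7) *
      cexp (2 * π * I * ((1 + τ) / 2) * m + π * I * τ * (m ^ 2 / 7)) * fiberTheta τ m) 0 := by
  refine hasSum_fiberTheta hτ (F := fun m => 2 * m + 7) ?_
  set w := (1 + τ) / 2
  have h0 : HasSum (fun n => jacobiTheta₂_term n w τ) 0 := by
    have := hasSum_jacobiTheta₂_term w hτ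
    rwa [jacobiTheta₂_half_period hτ] at this
  have hd : HasSum (fun n : ℤ => (2 * n + 1) * jacobiTheta₂_term n w τ)
      ((π * I)⁻¹ * jacobiTheta₂' w τ) := by
    have := ((hasSum_jacobiTheta₂'_term w hτ).mul_left (π * I)⁻¹).add h0
    rw [add_zero] at this
    refine this.congr_fun fun n => ?_
    have hπ : (π : ℂ) * I ≠ 0 := mul_ne_zero (ofReal_ne_zero.mpr Real.pi_ne_zero) I_ne_zero
    rw [jacobiTheta₂'_term]
    field_simp
  have hi (i : Fin 7) : HasSum (fun n : Fin 7 → ℤ =>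
      (2 * (n i : ℂ) + 1) * ∏ k, jacobiTheta₂_term (n k) w τ) 0 := by
    have hk : ∀ k, HasSum (fun n : ℤ => (if k = i then (2 * n + 1 : ℂ) else 1) *
        jacobiTheta₂_term n w τ) (if k = i then (π * I)⁻¹ * jacobiTheta₂' w τ else 0) := by
      intro k
      by_cases hki : k = i
      · simpa [hki] using hd
      · simpa [hki] using h0
    have := hasSum_pi_prod hk
    have hz : ∏ k : Fin 7, (if k = i then (π * I)⁻¹ * jacobiTheta₂' w τ else (0 : ℂ)) = 0 := by
      refine Finset.prod_eq_zero (Finset.mem_univ (i + 1)) (if_neg ?_)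
      simp
    rw [hz] at this
    refine this.congr_fun fun n => ?_
    rw [Finset.prod_mul_distrib, Finset.prod_ite_eq' Finset.univ i]
    simp
  have hsum := hasSum_sum (s := Finset.univ) fun i _ => hi i
  rw [Finset.sum_const_zero] at hsum
  refine hsum.congr_fun fun n => ?_
  rw [← Finset.sum_mul]
  congr 1
  rw [Finset.sum_add_distrib, ← Finset.mul_sum]
  push_cast
  simp

end Decomposition

/-- Adding the all-ones vector changes the integral representative but not its projection to the
span of A₆. -/
lemma fiberTheta_add_seven (τ : ℂ) (m : ℤ) : fiberTheta τ (m + 7) = fiberTheta τ m := by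
  let e : SumFiber m ≃ SumFiber (m + 7) :=
    (Equiv.addRight (1 : Fin 7 → ℤ)).subtypeEquiv fun n => by
      simp [Finset.sum_add_distrib]
  rw [fiberTheta, fiberTheta, ← e.tsum_eq]
  refine tsum_congr fun n => ?_
  have hm := n.cast_eq
  have hs : ∑ i, (((e n).1 i : ℤ) : ℂ) ^ 2 = ∑ i, (n.1 i : ℂ) ^ 2 + 2 * m + 7 := by
    have : ∀ i, (((e n).1 i : ℤ) : ℂ) ^ 2 = (n.1 i : ℂ) ^ 2 + 2 * (n.1 i : ℂ) + 1 := fun i => by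
      simp only [e, Equiv.subtypeEquiv_apply, Equiv.coe_addRight, Pi.add_apply, Pi.one_apply]
      push_cast; ring
    rw [Finset.sum_congr rfl fun i _ => this i, Finset.sum_add_distrib, Finset.sum_add_distrib,
      ← Finset.mul_sum, ← hm]
    simp
  rw [fiberTerm, fiberTerm, hs]
  congr 1; push_cast; ring

lemma fiberTheta_neg (τ : ℂ) (m : ℤ) : fiberTheta τ (-m) = fiberTheta τ m := by
  let e : SumFiber m ≃ SumFiber (-m) :=
    (Equiv.neg (Fin 7 → ℤ)).subtypeEquiv fun n => by simp
  rw [fiberTheta, fiberTheta, ← e.tsum_eq]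
  refine tsum_congr fun n => ?_
  rw [fiberTerm, fiberTerm]
  congr 1
  simp [e]

/-! ### The defect and its four relations. -/

/-- The difference of the two sides of the theta identity, up to normalisation. -/
noncomputable def defect (τ : ℂ) (m : ℤ) : ℂ :=
  8 / gaussPhi τ ^ 7 * fiberTheta τ m - (1 / gaussPhi (7 * τ) * (if (7 : ℤ) ∣ m then 1 else 0) +
    ∑ j ∈ Finset.range 7, 1 / gaussPhi (heckePoint τ j) * cexp (8 * π * I * j * m ^ 2 / 7))

lemma defect_add_seven (τ : ℂ) (m : ℤ) : defect τ (m + 7) = defect τ m := by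
  have h1 : (7 : ℤ) ∣ m + 7 ↔ (7 : ℤ) ∣ m := by omega
  have h2 (j : ℕ) : cexp (8 * π * I * j * ((m + 7 : ℤ) : ℂ) ^ 2 / 7) =
      cexp (8 * π * I * j * m ^ 2 / 7) := by
    refine exp_eq_exp_iff_exists_int.mpr ⟨4 * j * (2 * m + 7), ?_⟩
    push_cast; ring
  simp only [defect, fiberTheta_add_seven, h1, h2]

lemma defect_neg (τ : ℂ) (m : ℤ) : defect τ (-m) = defect τ m := by
  simp only [defect, fiberTheta_neg, dvd_neg, Int.cast_neg, neg_sq]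

lemma hasSum_defect {τ : ℂ} {c : ℤ → ℂ} {s₀ s₁ : ℂ} {s : ℕ → ℂ}
    (h₀ : HasSum (fun m => c m * fiberTheta τ m) s₀)
    (h₁ : HasSum (fun l => c (7 * l)) s₁)
    (h : ∀ j : ℕ, HasSum (fun m : ℤ => c m * cexp (8 * π * I * j * m ^ 2 / 7)) (s j))
    (hs : 8 / gaussPhi τ ^ 7 * s₀ = 1 / gaussPhi (7 * τ) * s₁ +
      ∑ j ∈ Finset.range 7, 1 / gaussPhi (heckePoint τ j) * s j) :
    HasSum (fun m => c m * defect τ m) 0 := by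
  have hi : Function.Injective fun l : ℤ => 7 * l := fun a b h => by dsimp only at h; omega
  have h₁' : HasSum (fun m => c m * (if (7 : ℤ) ∣ m then 1 else 0)) s₁ := by
    refine (hi.hasSum_iff ?_).mp (h₁.congr_fun fun l => ?_)
    · intro m hm
      rw [if_neg, mul_zero]
      rintro ⟨l, rfl⟩
      exact hm ⟨l, rfl⟩
    · simp
  have h2 := (h₀.mul_left (8 / gaussPhi τ ^ 7)).sub ((h₁'.mul_left (1 / gaussPhi (7 * τ))).add
    (hasSum_sum (s := Finset.range 7) fun j _ => (h j).mul_left (1 / gaussPhi (heckePoint τ j))))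
  rw [hs, sub_self] at h2
  refine h2.congr_fun fun m => ?_
  rw [defect, mul_sub, mul_add, Finset.mul_sum]
  congr 1
  · ring
  · congr 1
    · ring
    · exact Finset.sum_congr rfl fun j _ => by ring

section Relations

variable {τ : ℂ} (hτ : 0 < τ.im)

/-- With base e^{πiτ/28} both m²/7 and (m + 7/2)²/7 become integral exponents, namely (2m)² and
(2m+7)². -/
lemma nome_pow_even (τ : ℂ) (m : ℤ) : cexp (π * I * (τ / 28)) ^ ((2 * m).natAbs ^ 2) =
    cexp (π * I * τ * (m ^ 2 / 7)) := by
  rw [cexp_pow_natAbs_sq]; congr 1; push_cast; ring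

lemma nome_pow_odd (τ : ℂ) (m : ℤ) : cexp (π * I * (τ / 28)) ^ ((2 * m + 7).natAbs ^ 2) =
    cexp (π * I * τ * (m ^ 2 / 7 + m + 7 / 4)) := by
  rw [cexp_pow_natAbs_sq]; congr 1; push_cast; ring

lemma nome_even_mul (τ : ℂ) (m : ℤ) (j : ℕ) :
    cexp (π * I * τ * (m ^ 2 / 7)) * cexp (8 * π * I * j * m ^ 2 / 7) =
      cexp (π * I * heckePoint τ j * m ^ 2) := by
  rw [← exp_add, heckePoint]; congr 1; ring

/-- Completing the square to (m + 7/2)² introduces the extra phase πi(8jm + 14j), a multiple of 2πi;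
this is where 8j rather than j matters. -/
lemma nome_odd_mul (τ : ℂ) (m : ℤ) (j : ℕ) :
    cexp (π * I * τ * (m ^ 2 / 7 + m + 7 / 4)) * cexp (8 * π * I * j * m ^ 2 / 7) =
      cexp (π * I * heckePoint τ j * (((m + 3 : ℤ) : ℂ) + 1 / 2) ^ 2) := by
  rw [← exp_add, heckePoint]
  refine exp_eq_exp_iff_exists_int.mpr ⟨-(4 * j * m + 7 * j), ?_⟩
  push_cast; ring

lemma neg_one_zpow_seven_mul (l : ℤ) : (-1 : ℂ) ^ (7 * l) = (-1) ^ l := by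
  rw [zpow_mul]; norm_num

include hτ

lemma defect_relation_theta3 (hinj : (heckeValue thetaRatio τ).Injective) :
    HasSum (fun m => defect τ m * cexp (π * I * (τ / 28)) ^ ((2 * m).natAbs ^ 2)) 0 := by
  simp only [nome_pow_even]
  refine (hasSum_defect (c := fun m => cexp (π * I * τ * (m ^ 2 / 7))) (s₀ := theta3 τ ^ 7)
    (s₁ := theta3 (7 * τ)) (s := fun j => theta3 (heckePoint τ j)) ?_ ?_ ?_ ?_).congr_fun
      fun m => mul_comm _ _
  · exact (hasSum_fiberTheta_one hτ 0).congr_fun fun m => by simp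
  · refine (hasSum_theta3 (seven_mul_im_pos hτ)).congr_fun fun l => ?_
    congr 1; push_cast; ring
  · intro j
    exact (hasSum_theta3 (heckePoint_im_pos hτ j)).congr_fun fun m => nome_even_mul τ m j
  · have h := sum_heckeValue_thetaRatio hτ hinj
    rw [sum_heckeValue] at h
    simp only [thetaRatio] at h
    rw [div_pow] at h
    simp only [one_div_mul_eq_div]
    rw [h]; ring

lemma defect_relation_theta4 (hinj : (heckeValue thetaRatio τ).Injective) :
    HasSum (fun m => (-1) ^ m * defect τ m * cexp (π * I * (τ / 28)) ^ ((2 * m).natAbs ^ 2)) 0 := by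
  simp only [nome_pow_even]
  refine (hasSum_defect (c := fun m => (-1) ^ m * cexp (π * I * τ * (m ^ 2 / 7)))
    (s₀ := theta4 τ ^ 7) (s₁ := theta4 (7 * τ)) (s := fun j => theta4 (heckePoint τ j))
    ?_ ?_ ?_ ?_).congr_fun fun m => by ring
  · refine (hasSum_fiberTheta_one hτ (1 / 2)).congr_fun fun m => ?_
    rw [← cexp_pi_mul_int, ← exp_add]
    congr 2; ring
  · refine (hasSum_theta4 (seven_mul_im_pos hτ)).congr_fun fun l => ?_
    rw [neg_one_zpow_seven_mul]
    congr 2; push_cast; ring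
  · intro j
    refine (hasSum_theta4 (heckePoint_im_pos hτ j)).congr_fun fun m => ?_
    rw [mul_assoc, nome_even_mul τ m j]
  · have h := sum_heckeValue_thetaRatio_inv hτ hinj
    have hv : ∀ i, (heckeValue thetaRatio τ i)⁻¹ =
        heckeValue (fun τ => theta4 τ / gaussPhi τ) τ i := by
      rintro (_ | j)
      · exact thetaRatio_inv (seven_mul_im_pos hτ)
      · exact thetaRatio_inv (heckePoint_im_pos hτ j)
    simp only [hv] at h
    rw [sum_heckeValue, thetaRatio_inv hτ, div_pow] at h
    simp only [one_div_mul_eq_div]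
    rw [h]; ring

lemma defect_relation_theta2 (hinj : (heckeValue thetaRatio τ).Injective) :
    HasSum (fun m => defect τ m * cexp (π * I * (τ / 28)) ^ ((2 * m + 7).natAbs ^ 2)) 0 := by
  simp only [nome_pow_odd]
  refine (hasSum_defect (c := fun m => cexp (π * I * τ * (m ^ 2 / 7 + m + 7 / 4)))
    (s₀ := theta2 τ ^ 7) (s₁ := theta2 (7 * τ)) (s := fun j => theta2 (heckePoint τ j))
    ?_ ?_ ?_ ?_).congr_fun fun m => by ring
  · rw [theta2, mul_pow]
    refine ((hasSum_fiberTheta_one hτ (τ / 2)).mul_left _).congr_fun fun m => ?_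
    rw [← mul_assoc, ← exp_nat_mul, ← exp_add]
    congr 2; push_cast; ring
  · refine (hasSum_theta2 (seven_mul_im_pos hτ)).congr_fun fun l => ?_
    congr 1; push_cast; ring
  · intro j
    refine (((Equiv.addRight (3 : ℤ)).hasSum_iff).mpr
      (hasSum_theta2 (heckePoint_im_pos hτ j))).congr_fun fun m => ?_
    exact nome_odd_mul τ m j
  · have h := sum_heckeValue_thetaRatio' hτ hinj
    rw [sum_heckeValue] at h
    simp only [thetaRatio'] at h
    rw [div_pow] at h
    simp only [one_div_mul_eq_div]
    rw [h]; ring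

/-- The coset side is zero. On the other side 2(7l) + 7 = 7(2l + 1) produces the factor 7, and the
shift m + 3 reverses the sign, so `sum_theta2_mul_gaussPhi` makes the two parts cancel. -/
lemma defect_relation_derivative :
    HasSum (fun m : ℤ => (-1) ^ m * (2 * m + 7) * defect τ m *
      cexp (π * I * (τ / 28)) ^ ((2 * m + 7).natAbs ^ 2)) 0 := by
  simp only [nome_pow_odd]
  have h7 := seven_mul_im_pos hτ
  refine (hasSum_defect
    (c := fun m => (-1) ^ m * (2 * m + 7) * cexp (π * I * τ * (m ^ 2 / 7 + m + 7 / 4)))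
    (s₀ := 0) (s₁ := 7 * (theta2 (7 * τ) * gaussPhi (7 * τ) ^ 2))
    (s := fun j => -(theta2 (heckePoint τ j) * gaussPhi (heckePoint τ j) ^ 2))
    ?_ ?_ ?_ ?_).congr_fun fun m => by ring
  · rw [← mul_zero (cexp (7 * π * I * τ / 4))]
    refine ((hasSum_fiberTheta_half_period hτ).mul_left _).congr_fun fun m => ?_
    have h : (-1) ^ m * cexp (π * I * τ * (m ^ 2 / 7 + m + 7 / 4)) = cexp (7 * π * I * τ / 4) *
        cexp (2 * π * I * ((1 + τ) / 2) * m + π * I * τ * (m ^ 2 / 7)) := by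
      rw [← cexp_pi_mul_int, ← exp_add, ← exp_add]
      congr 1; ring
    linear_combination (2 * m + 7) * fiberTheta τ m * h
  · refine ((hasSum_theta2_mul_gaussPhi_sq h7).mul_left 7).congr_fun fun l => ?_
    rw [neg_one_zpow_seven_mul]
    have h : cexp (π * I * τ * (((7 * l : ℤ) : ℂ) ^ 2 / 7 + ((7 * l : ℤ) : ℂ) + 7 / 4)) =
        cexp (π * I * (7 * τ) * (l + 1 / 2) ^ 2) := by
      congr 1; push_cast; ring
    rw [h]; push_cast; ring
  · intro j
    refine (((Equiv.addRight (3 : ℤ)).hasSum_iff).mpr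
      (hasSum_theta2_mul_gaussPhi_sq (heckePoint_im_pos hτ j))).neg.congr_fun fun m => ?_
    have h := nome_odd_mul τ m j
    have h3 : (-1 : ℂ) ^ (m + 3) = -(-1) ^ m := by
      rw [zpow_add₀ (by norm_num)]; norm_num
    simp only [Function.comp, Equiv.coe_addRight]
    rw [mul_assoc _ (cexp _), h, h3]
    push_cast; ring
  · have h := sum_theta2_mul_gaussPhi hτ
    have hz := gaussPhi_ne_zero h7
    have h1 : 1 / gaussPhi (7 * τ) * (7 * (theta2 (7 * τ) * gaussPhi (7 * τ) ^ 2)) =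
        7 * (theta2 (7 * τ) * gaussPhi (7 * τ)) := by field_simp
    have h2 : ∀ j ∈ Finset.range 7, 1 / gaussPhi (heckePoint τ j) *
        -(theta2 (heckePoint τ j) * gaussPhi (heckePoint τ j) ^ 2) =
        -(theta2 (heckePoint τ j) * gaussPhi (heckePoint τ j)) := fun j _ => by
      have := gaussPhi_ne_zero (heckePoint_im_pos hτ j)
      field_simp
    rw [h1, Finset.sum_congr rfl h2, Finset.sum_neg_distrib, h]
    ring

end Relations

lemma exists_defect_eq_zero : ∃ Y > 0, ∀ τ : ℂ, Y ≤ τ.im → ∀ m, defect τ m = 0 := by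
  obtain ⟨ρ, hρ, hmain⟩ := exists_eq_zero_of_theta_relations
  obtain ⟨Y₁, hY₁, hinj⟩ := exists_heckeValue_injective
  have hlim : Tendsto (fun y : ℝ => Real.exp (-π * (y / 28))) atTop (𝓝 0) := by
    refine Real.tendsto_exp_atBot.comp ?_
    exact (tendsto_id.atTop_div_const (by norm_num : (0 : ℝ) < 28)).const_mul_atTop_of_neg
      (neg_lt_zero.mpr Real.pi_pos)
  obtain ⟨Y₂, hY₂⟩ := eventually_atTop.mp (hlim.eventually (gt_mem_nhds hρ))
  refine ⟨max Y₁ Y₂, lt_max_of_lt_left hY₁, fun τ hτ => ?_⟩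
  have h1 := hinj τ ((le_max_left _ _).trans hτ)
  have h0 : 0 < τ.im := hY₁.trans_le ((le_max_left _ _).trans hτ)
  have h2 : ‖cexp (π * I * (τ / 28))‖ < ρ := by
    rw [norm_nome]
    have him : (τ / 28).im = τ.im / 28 := by
      rw [show τ / 28 = ((1 / 28 : ℝ) : ℂ) * τ by push_cast; ring, Complex.im_ofReal_mul]; ring
    rw [him]
    exact hY₂ _ ((le_max_right _ _).trans hτ)
  exact hmain _ (exp_ne_zero _) h2 (defect τ) (defect_add_seven τ) (defect_neg τ)
    (defect_relation_theta3 h0 h1) (defect_relation_theta4 h0 h1) (defect_relation_theta2 h0 h1)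
    (defect_relation_derivative h0)

/-! ### Coordinates on the dual lattice and its cosets. -/

lemma single_sub_single_mem (i j : Fin 7) :
    (EuclideanSpace.single i (1 : ℝ) - EuclideanSpace.single j (1 : ℝ)) ∈ latticeA6 := by
  refine ⟨fun k => ⟨(if k = i then 1 else 0) - (if k = j then 1 else 0), ?_⟩, ?_⟩
  · simp
  · simp [Finset.sum_sub_distrib]

lemma sum_eq_zero_of_mem_dualLattice {r : EuclideanSpace ℝ (Fin 7)}
    (hr : r ∈ dualLattice latticeA6) : ∑ i, r i = 0 := by
  refine Submodule.span_induction (p := fun x _ => ∑ i, x i = 0) ?_ ?_ ?_ ?_ hr.1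
  · exact fun x hx => hx.2
  · simp
  · intro x y _ _ hx hy
    simp [Finset.sum_add_distrib, hx, hy]
  · intro a x _ hx
    simp [← Finset.mul_sum, hx]

/-- Every vector of `A₆^*` is an integral vector minus the mean of its coordinates. -/
lemma exists_eq_of_mem_dualLattice {r : EuclideanSpace ℝ (Fin 7)}
    (hr : r ∈ dualLattice latticeA6) :
    ∃ n : Fin 7 → ℤ, ∀ i, r i = n i - ((∑ k, n k : ℤ) : ℝ) / 7 := by
  have h : ∀ i, ∃ m : ℤ, r i - r 0 = m := by
    intro i
    obtain ⟨m, hm⟩ := hr.2 _ (single_sub_single_mem i 0)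
    refine ⟨m, ?_⟩
    rw [← hm, inner_sub_right]
    simp [EuclideanSpace.inner_single_right]
  choose n hn using h
  have h0 := sum_eq_zero_of_mem_dualLattice hr
  have h1 : ∑ i, (r i - r 0) = ∑ i, (n i : ℝ) := Finset.sum_congr rfl fun i _ => hn i
  rw [Finset.sum_sub_distrib, h0] at h1
  simp only [Finset.sum_const, Finset.card_univ, Fintype.card_fin, nsmul_eq_mul] at h1
  refine ⟨n, fun i => ?_⟩
  have h2 := hn i
  push_cast at h1 ⊢
  linarith

/-- The vectors of the coset `r + A₆`, as integral vectors of fixed coordinate sum. -/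
lemma exists_fiber_equiv (n : Fin 7 → ℤ) : ∃ e : SumFiber (∑ k, n k) ≃ latticeA6,
    ∀ x i, ((e x : latticeA6) : EuclideanSpace ℝ (Fin 7)) i = x.1 i - n i := by
  let f : SumFiber (∑ k, n k) → latticeA6 := fun x =>
    ⟨WithLp.toLp 2 fun i => (x.1 i : ℝ) - n i, fun i => ⟨x.1 i - n i, by simp⟩, by
      have h : ∑ i, (x.1 i : ℝ) = ∑ i, (n i : ℝ) := by exact_mod_cast x.2
      simp [Finset.sum_sub_distrib, h]⟩
  have hf : f.Bijective := by
    constructor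
    · intro x y hxy
      apply Subtype.ext
      funext i
      have h := congrArg (fun v : latticeA6 => (v : EuclideanSpace ℝ (Fin 7)) i) hxy
      simpa [f] using h
    · rintro ⟨v, hv⟩
      have hv0 : ∑ i, v i = 0 := hv.2
      have h1 : ∀ i, ∃ m : ℤ, v i = m := hv.1
      choose m hm using h1
      refine ⟨⟨fun i => m i + n i, ?_⟩, ?_⟩
      · have h : ∑ i, (m i : ℝ) = 0 := by rw [← hv0]; exact Finset.sum_congr rfl fun i _ => (hm i).symm
        have h' : ∑ i, m i = 0 := by exact_mod_cast h
        rw [Finset.sum_add_distrib, h', zero_add]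
      · apply Subtype.ext
        ext i
        simp [f, hm i]
  exact ⟨Equiv.ofBijective f hf, fun x i => rfl⟩

section Coset

variable {r : EuclideanSpace ℝ (Fin 7)} {n : Fin 7 → ℤ}
  (hn : ∀ i, r i = n i - ((∑ k, n k : ℤ) : ℝ) / 7)
include hn

lemma mem_latticeA6_iff : r ∈ latticeA6 ↔ (7 : ℤ) ∣ ∑ k, n k := by
  constructor
  · rintro ⟨h, -⟩
    obtain ⟨m, hm⟩ := h 0
    refine ⟨n 0 - m, ?_⟩
    have h1 : ((∑ k, n k : ℤ) : ℝ) = 7 * (n 0 - m) := by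
      have := hn 0
      rw [hm] at this
      linarith
    exact_mod_cast h1
  · rintro ⟨c, hc⟩
    refine ⟨fun i => ⟨n i - c, ?_⟩, ?_⟩
    · rw [hn i, hc]; push_cast; ring
    · rw [Finset.sum_congr rfl fun i _ => hn i, Finset.sum_sub_distrib]
      simp
      ring

lemma norm_sq_eq {m : ℤ} (hm : m = ∑ k, n k) (x : SumFiber m) {v : EuclideanSpace ℝ (Fin 7)}
    (hv : ∀ i, v i = x.1 i - n i) :
    ‖r + v‖ ^ 2 = ∑ i, (x.1 i : ℝ) ^ 2 - (m : ℝ) ^ 2 / 7 := by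
  have hx : ∑ i, (x.1 i : ℝ) = m := by exact_mod_cast x.2
  have h : ∀ i, ‖(r + v) i‖ ^ 2 = (x.1 i : ℝ) ^ 2 - 2 * (m / 7) * x.1 i + (m / 7) ^ 2 := by
    intro i
    rw [Real.norm_eq_abs, sq_abs, PiLp.add_apply, hn i, hv i, ← hm]
    ring
  rw [EuclideanSpace.norm_sq_eq, Finset.sum_congr rfl fun i _ => h i, Finset.sum_add_distrib,
    Finset.sum_sub_distrib, ← Finset.mul_sum, hx]
  simp
  ring

lemma hasSum_thetaTerm {τ : ℂ} (hτ : 0 < τ.im) :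
    HasSum (fun v : latticeA6 => thetaTerm r τ v) (fiberTheta τ (∑ k, n k)) := by
  obtain ⟨e, he⟩ := exists_fiber_equiv n
  refine e.hasSum_iff.mp ((summable_fiberTerm hτ (∑ k, n k)).hasSum.congr_fun fun x => ?_)
  have h := norm_sq_eq hn rfl x (he x)
  rw [Function.comp_apply, thetaTerm, fiberTerm, h]
  congr 1
  push_cast
  ring

/-- The principal logarithm of `eps7` is 2πi/7, so the power is e^{-πijr²}. With r² = ∑ n_k² - m²/7,
the congruence ∑ n_k² ≡ m² modulo 2 turns this into e^{8πijm²/7}. -/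
lemma eps7_cpow (j : ℕ) : eps7 ^ (-(7 * (j : ℂ) * ((‖r‖ ^ 2 : ℝ) : ℂ) / 2)) =
    cexp (8 * π * I * j * ((∑ k, n k : ℤ) : ℂ) ^ 2 / 7) := by
  have hlog : Complex.log eps7 = 2 * π * I / 7 := by
    rw [eps7]
    have him : (2 * π * I / 7 : ℂ).im = 2 * π / 7 := by
      rw [show (2 * π * I / 7 : ℂ) = ((2 * π / 7 : ℝ) : ℂ) * I by push_cast; ring, Complex.mul_I_im,
        Complex.ofReal_re]
    refine Complex.log_exp ?_ ?_ <;> rw [him] <;> linarith [Real.pi_pos]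
  have hne : eps7 ≠ 0 := exp_ne_zero _
  have h := norm_sq_eq hn rfl ⟨n, rfl⟩ (v := 0) (by simp)
  rw [add_zero] at h
  have hpar : Even (∑ k, n k ^ 2 + (∑ k, n k) ^ 2) := by
    have h1 : ∀ a b : ZMod 2, a ^ 2 = a := by decide
    have h2 : ((∑ k, n k ^ 2 + (∑ k, n k) ^ 2 : ℤ) : ZMod 2) = 0 := by
      push_cast
      simp only [h1 _ 0]
      exact CharTwo.add_self_eq_zero _
    exact even_iff_two_dvd.mpr ((ZMod.intCast_zmod_eq_zero_iff_dvd _ 2).mp h2)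
  obtain ⟨c, hc⟩ := hpar
  have hc' : ∑ k, (n k : ℂ) ^ 2 + ((∑ k, n k : ℤ) : ℂ) ^ 2 = c + c := by exact_mod_cast hc
  rw [cpow_def_of_ne_zero hne, hlog, h]
  refine exp_eq_exp_iff_exists_int.mpr ⟨-(j * c), ?_⟩
  push_cast at hc' ⊢
  linear_combination (-π * I * j) * hc'

end Coset

/-! ### Translation into eta functions and analytic continuation. -/

/-- As 8j/7 = j + j/7 and φ has period 1, the translation by 8j is invisible on the eta side. -/
lemma gaussPhi_heckePoint (τ : ℂ) (j : ℕ) : gaussPhi (heckePoint τ j) = gaussPhi ((τ + j) / 7) := by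
  rw [← gaussPhi_add_nat ((τ + j) / 7) j, heckePoint]; congr 1; ring

lemma shifted_im_pos {τ : ℂ} (hτ : 0 < τ.im) (j : ℕ) : 0 < ((τ + j) / 7).im := by
  rw [show ((τ + j) / 7 : ℂ) = ((1 / 7 : ℝ) : ℂ) * τ + ((j / 7 : ℝ) : ℂ) by push_cast; ring,
    Complex.add_im, Complex.im_ofReal_mul, Complex.ofReal_im]
  positivity

/-- The right-hand side of the theta identity in terms of eta functions. -/
noncomputable def etaSide (r : EuclideanSpace ℝ (Fin 7)) (τ : ℂ) : ℂ :=
  (1 / 8 : ℂ) * (ModularForm.eta τ ^ 14 / ModularForm.eta (2 * τ) ^ 7) *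
    (ModularForm.eta (14 * τ) / ModularForm.eta (7 * τ) ^ 2 * latticeDelta latticeA6 r +
      ∑ j ∈ Finset.range 7, eps7 ^ (-(7 * (j : ℂ) * ((‖r‖ ^ 2 : ℝ) : ℂ) / 2)) *
        (ModularForm.eta (2 * ((τ + j) / 7)) / ModularForm.eta ((τ + j) / 7) ^ 2))

lemma cosetTheta_eq_etaSide_of_defect {r : EuclideanSpace ℝ (Fin 7)} {n : Fin 7 → ℤ}
    (hn : ∀ i, r i = n i - ((∑ k, n k : ℤ) : ℝ) / 7) {τ : ℂ} (hτ : 0 < τ.im)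
    (h : defect τ (∑ k, n k) = 0) : cosetTheta latticeA6 r τ = etaSide r τ := by
  have hphi := gaussPhi_ne_zero hτ
  have h1 : cosetTheta latticeA6 r τ = fiberTheta τ (∑ k, n k) := (hasSum_thetaTerm hn hτ).tsum_eq
  have h2 : ModularForm.eta τ ^ 14 / ModularForm.eta (2 * τ) ^ 7 = gaussPhi τ ^ 7 := by
    rw [gaussPhi_eq_eta hτ, div_pow, ← pow_mul]
  have h3 : ModularForm.eta (14 * τ) / ModularForm.eta (7 * τ) ^ 2 = 1 / gaussPhi (7 * τ) := by
    rw [gaussPhi_eq_eta (seven_mul_im_pos hτ), one_div_div]; congr 2; ring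
  have h4 (j : ℕ) : ModularForm.eta (2 * ((τ + j) / 7)) / ModularForm.eta ((τ + j) / 7) ^ 2 =
      1 / gaussPhi (heckePoint τ j) := by
    rw [gaussPhi_heckePoint, gaussPhi_eq_eta (shifted_im_pos hτ j), one_div_div]
  have h5 : latticeDelta latticeA6 r = if (7 : ℤ) ∣ ∑ k, n k then 1 else 0 := by
    unfold latticeDelta
    by_cases hd : (7 : ℤ) ∣ ∑ k, n k
    · rw [if_pos ((mem_latticeA6_iff hn).mpr hd), if_pos hd]
    · rw [if_neg (mt (mem_latticeA6_iff hn).mp hd), if_neg hd]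
  rw [etaSide, h1, h2, h3, h5]
  simp only [h4, eps7_cpow hn]
  rw [defect, sub_eq_zero] at h
  simp only [mul_comm (cexp _)]
  rw [← h]
  field_simp

lemma norm_thetaTerm (r v : EuclideanSpace ℝ (Fin 7)) (τ : ℂ) :
    ‖thetaTerm r τ v‖ = Real.exp (-π * ‖r + v‖ ^ 2 * τ.im) := by
  rw [thetaTerm, show (2 * π * I * τ * ((‖r + v‖ ^ 2 / 2 : ℝ) : ℂ) : ℂ) =
    ((π * ‖r + v‖ ^ 2 : ℝ) : ℂ) * τ * I by push_cast; ring, norm_exp, Complex.mul_I_re,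
    Complex.im_ofReal_mul]
  congr 1; ring

lemma differentiableOn_cosetTheta {r : EuclideanSpace ℝ (Fin 7)} {n : Fin 7 → ℤ}
    (hn : ∀ i, r i = n i - ((∑ k, n k : ℤ) : ℝ) / 7) :
    DifferentiableOn ℂ (cosetTheta latticeA6 r) {τ | 0 < τ.im} := by
  intro τ hτ
  have hτ' : 0 < τ.im := hτ
  have hopen : IsOpen {σ : ℂ | τ.im / 2 < σ.im} := isOpen_lt continuous_const continuous_im
  have hmem : τ ∈ {σ : ℂ | τ.im / 2 < σ.im} := by
    simp only [Set.mem_ofPred_eq]; linarith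
  -- The modulus of a term depends only on Im σ and does not increase with it, so the series at i
  -- Im(τ)/2 dominates on the half-plane above that height.
  have hI : 0 < (((τ.im / 2 : ℝ) : ℂ) * I).im := by
    rw [Complex.mul_I_im, Complex.ofReal_re]; positivity
  have hd : DifferentiableOn ℂ (fun σ => ∑' v : latticeA6, thetaTerm r σ v)
      {σ : ℂ | τ.im / 2 < σ.im} := by
    refine differentiableOn_tsum_of_summable_norm (hasSum_thetaTerm hn hI).summable.norm
      (fun v => ?_) hopen fun v σ hσ => ?_
    · unfold thetaTerm; fun_prop
    · rw [norm_thetaTerm, norm_thetaTerm, Real.exp_le_exp, Complex.mul_I_im, Complex.ofReal_re]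
      have h1 : (τ.im / 2) ≤ σ.im := le_of_lt hσ
      have h2 : 0 ≤ π * ‖r + (v : EuclideanSpace ℝ (Fin 7))‖ ^ 2 := by positivity
      nlinarith [mul_le_mul_of_nonneg_left h1 h2]
  exact (hd.differentiableAt (hopen.mem_nhds hmem)).differentiableWithinAt

lemma differentiableOn_etaSide (r : EuclideanSpace ℝ (Fin 7)) :
    DifferentiableOn ℂ (etaSide r) {τ | 0 < τ.im} := by
  intro τ hτ
  have hτ' : 0 < τ.im := hτ
  have h14 : 0 < (14 * τ).im := by simpa using hτ'
  have hcomp (f : ℂ → ℂ) (hf : DifferentiableAt ℂ f τ) (h : 0 < (f τ).im) :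
      DifferentiableAt ℂ (fun σ => ModularForm.eta (f σ)) τ :=
    (ModularForm.differentiableAt_eta_of_mem_upperHalfPlaneSet h).comp τ hf
  have hne {z : ℂ} (h : 0 < z.im) (k : ℕ) : ModularForm.eta z ^ k ≠ 0 :=
    pow_ne_zero _ (ModularForm.eta_ne_zero h)
  refine DifferentiableAt.differentiableWithinAt ?_
  unfold etaSide
  refine DifferentiableAt.mul (DifferentiableAt.mul (by fun_prop) (DifferentiableAt.div
    ((hcomp (fun σ => σ) (by fun_prop) hτ').fun_pow _)
    ((hcomp (fun σ => 2 * σ) (by fun_prop) (two_mul_im_pos hτ')).fun_pow _)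
    (hne (two_mul_im_pos hτ') 7))) (DifferentiableAt.add (DifferentiableAt.mul (DifferentiableAt.div
      (hcomp (fun σ => 14 * σ) (by fun_prop) h14)
      ((hcomp (fun σ => 7 * σ) (by fun_prop) (seven_mul_im_pos hτ')).fun_pow _)
      (hne (seven_mul_im_pos hτ') 2)) (by fun_prop)) (DifferentiableAt.fun_sum fun j _ =>
        DifferentiableAt.mul (by fun_prop) (DifferentiableAt.div
          (hcomp (fun σ => 2 * ((σ + j) / 7)) (by fun_prop) (two_mul_im_pos (shifted_im_pos hτ' j)))
          ((hcomp (fun σ => (σ + j) / 7) (by fun_prop) (shifted_im_pos hτ' j)).fun_pow _)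
          (hne (shifted_im_pos hτ' j) 2))))

/-- The relations give equality only high in the half-plane; both sides are holomorphic on the
connected upper half-plane, so equality near one point there is enough. -/
lemma cosetTheta_eq_etaSide {r : EuclideanSpace ℝ (Fin 7)} {n : Fin 7 → ℤ}
    (hn : ∀ i, r i = n i - ((∑ k, n k : ℤ) : ℝ) / 7) {τ : ℂ} (hτ : 0 < τ.im) :
    cosetTheta latticeA6 r τ = etaSide r τ := by
  obtain ⟨Y, hY, hdef⟩ := exists_defect_eq_zero
  have hopen : IsOpen {σ : ℂ | 0 < σ.im} := isOpen_lt continuous_const continuous_im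
  have hconn : IsPreconnected {σ : ℂ | 0 < σ.im} := (convex_halfSpace_im_gt 0).isPreconnected
  have hz : 0 < (((Y + 1 : ℝ) : ℂ) * I).im := by
    rw [Complex.mul_I_im, Complex.ofReal_re]; positivity
  refine ((differentiableOn_cosetTheta hn).analyticOnNhd hopen).eqOn_of_preconnected_of_eventuallyEq
    ((differentiableOn_etaSide r).analyticOnNhd hopen) hconn hz ?_ hτ
  have hopenY : IsOpen {σ : ℂ | Y < σ.im} := isOpen_lt continuous_const continuous_im
  have hmem : ((Y + 1 : ℝ) : ℂ) * I ∈ {σ : ℂ | Y < σ.im} := by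
    simp only [Set.mem_ofPred_eq]
    rw [Complex.mul_I_im, Complex.ofReal_re]; linarith
  filter_upwards [hopenY.mem_nhds hmem] with σ hσ
  have hσ' : Y < σ.im := hσ
  exact cosetTheta_eq_etaSide_of_defect hn (hY.trans hσ') (hdef σ hσ'.le _)

end CosetTheta

/-- With `q = e^{2πiτ}`, `η(q^k)` is `ModularForm.eta (k * τ)`; since
`ε^j q^{1/7} = e^{2πi(τ + j)/7}`, `η(ε^j q^{1/7})` is `ModularForm.eta ((τ + j) / 7)`. -/
theorem mainTheorem11 (r : EuclideanSpace ℝ (Fin 7))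
    (hr : r ∈ CosetTheta.dualLattice CosetTheta.latticeA6) (τ : ℂ) (hτ : 0 < τ.im) :
    Summable (fun v : CosetTheta.latticeA6 =>
        CosetTheta.thetaTerm r τ (v : EuclideanSpace ℝ (Fin 7))) ∧
    CosetTheta.cosetTheta CosetTheta.latticeA6 r τ =
      (1 / 8 : ℂ) * (ModularForm.eta τ ^ 14 / ModularForm.eta (2 * τ) ^ 7) *
        (ModularForm.eta (14 * τ) / ModularForm.eta (7 * τ) ^ 2 *
            CosetTheta.latticeDelta CosetTheta.latticeA6 r +
          ∑ j ∈ Finset.range 7,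
            CosetTheta.eps7 ^ (-(7 * (j : ℂ) * ((‖r‖ ^ 2 : ℝ) : ℂ) / 2)) *
              (ModularForm.eta (2 * ((τ + j) / 7)) / ModularForm.eta ((τ + j) / 7) ^ 2)) := by
  obtain ⟨n, hn⟩ := CosetTheta.exists_eq_of_mem_dualLattice hr
  exact ⟨(CosetTheta.hasSum_thetaTerm hn hτ).summable, CosetTheta.cosetTheta_eq_etaSide hn hτ⟩
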